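/- Let $d\ge 0$ and let $X=(X_k)_{k\in\mathbb Z^d}$ be a stationary process with values in $\{0,1\}$ on a probability space, ergodic under the shifts of $\mathbb Z^d$. Let $\mu$ be a spectral measure of $X$, i.e. a finite (positive) Borel measure on $\mathbb R^d$ (for instance the one carried by $[0,1)^d$) with $$E[X_0X_k]=\int_{\mathbb R^d} e^{2\pi i\langle k,x\rangle}\,d\mu(x)\qquad\text{for all }k\in\mathbb Z^d .$$ Let $\chi=\{k\in\mathbb Z^d: X_k=1\}\subset\mathbb R^d$ and, for $R>0$, let $$\gamma_R=\frac1{|B_R|}\sum_{x,y\in\chi\cap B_R}\delta_{y-x},$$ where $B_R$ is the ball of radius $R$ centered at $0$ and $|B_R|$ is its Lebesgue measure. The autocorrelation of $\chi$ is the limit of $\gamma_R$ in the vague topology as $R\to\infty$ (if it exists), and the diffraction measure of $\chi$ is the Fourier transform $\widehat\gamma$ of the autocorrelation $\gamma$ in the sense of tempered distributions, with $\widehat f(x)=\int f(y)e^{-2\pi i\langle x,y\rangle}dy$. Then: 1. Almost surely, $\chi$ admits an autocorrelation $\gamma$, and $$\gamma=\sum_{k\in\mathbb Z^d}E[X_0X_k]\,\delta_k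 .$$ 2. The measure $\gamma$ is tempered, and almost surely the diffraction measure of $\chi$ is $\widehat\gamma=\mu_p$, where $\mu_p$ is the ($\mathbb Z^d$-periodic, tempered) measure $$\mu_p(A)=\sum_{k\in\mathbb Z^d}\mu(A-k),\qquad A\subset\mathbb R^d\text{ Borel}.$$ -/

import Mathlib

namespace LatticeDiffraction

open MeasureTheory Filter Topology
open scoped FourierTransform SchwartzMap ENNReal

noncomputable section

/-! ### Processes indexed by `ℤ^d` -/

/-- The trajectory `k ↦ X k ω` of a real-valued process indexed by `ℤ^d`. -/
def path {d : ℕ} {Ω : Type*} (X : (Fin d → ℤ) → Ω → ℝ) (ω : Ω) : (Fin d → ℤ) → ℝ :=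
  fun k => X k ω

/-- The shift by `k` on the space of trajectories. -/
def shift {d : ℕ} (k : Fin d → ℤ) (x : (Fin d → ℤ) → ℝ) : (Fin d → ℤ) → ℝ :=
  fun j => x (j + k)

/-- The law of a process, on the space of trajectories with its product σ-algebra. -/
def law {d : ℕ} {Ω : Type*} [MeasurableSpace Ω] (P : Measure Ω) (X : (Fin d → ℤ) → Ω → ℝ) :
    Measure ((Fin d → ℤ) → ℝ) :=
  P.map (path X)

/-- Stationarity: the law is invariant under all the shifts of `ℤ^d`. -/
def IsStationaryProcess {d : ℕ} {Ω : Type*} [MeasurableSpace Ω] (P : Measure Ω)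
    (X : (Fin d → ℤ) → Ω → ℝ) : Prop :=
  ∀ k : Fin d → ℤ, (law P X).map (shift k) = law P X

/-- Ergodicity (under the whole group `ℤ^d`): an event on the space of trajectories which is
invariant under all the shifts has probability `0` or `1`. -/
def IsErgodicProcess {d : ℕ} {Ω : Type*} [MeasurableSpace Ω] (P : Measure Ω)
    (X : (Fin d → ℤ) → Ω → ℝ) : Prop :=
  ∀ A : Set ((Fin d → ℤ) → ℝ), MeasurableSet A → (∀ k : Fin d → ℤ, shift k ⁻¹' A = A) →
    law P X A = 0 ∨ law P X A = 1

/-- The correlation `E[X₀ X_k]` (not centred). -/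
def correlation {d : ℕ} {Ω : Type*} [MeasurableSpace Ω] (P : Measure Ω)
    (X : (Fin d → ℤ) → Ω → ℝ) (k : Fin d → ℤ) : ℝ :=
  ∫ ω, X 0 ω * X k ω ∂P

/-! ### The lattice `ℤ^d` in `ℝ^d` -/

/-- The point of `ℝ^d` with the integer coordinates `k`. -/
def latticePoint {d : ℕ} (k : Fin d → ℤ) : EuclideanSpace ℝ (Fin d) :=
  WithLp.toLp 2 fun i => (k i : ℝ)

/-- The finite measure `μ` on `ℝ^d` is a spectral measure of the process `X`: its Fourier
coefficients at the points of `ℤ^d` are the correlations of `X`, that is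
`E[X₀ X_k] = ∫ exp (2π i ⟨k, x⟩) dμ(x)`. It may be carried by `[0,1)^d`, but need not be. -/
structure IsSpectralMeasure {d : ℕ} {Ω : Type*} [MeasurableSpace Ω] (P : Measure Ω)
    (X : (Fin d → ℤ) → Ω → ℝ) (μ : Measure (EuclideanSpace ℝ (Fin d))) : Prop where
  isFinite : IsFiniteMeasure μ
  fourierCoeff_eq : ∀ k : Fin d → ℤ,
    ∫ x, Complex.exp (2 * Real.pi * Complex.I * ((inner ℝ (latticePoint k) x : ℝ) : ℂ)) ∂μ
      = (correlation P X k : ℂ)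

/-- The random set `χ = {k ∈ ℤ^d : X_k = 1}`, as a subset of `ℝ^d`. -/
def pointSet {d : ℕ} {Ω : Type*} (X : (Fin d → ℤ) → Ω → ℝ) (ω : Ω) :
    Set (EuclideanSpace ℝ (Fin d)) :=
  latticePoint '' {k | X k ω = 1}

/-- The measure `∑_{k ∈ ℤ^d} E[X₀ X_k] δ_k` on `ℝ^d`. -/
def correlationMeasure {d : ℕ} {Ω : Type*} [MeasurableSpace Ω] (P : Measure Ω)
    (X : (Fin d → ℤ) → Ω → ℝ) : Measure (EuclideanSpace ℝ (Fin d)) :=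
  Measure.sum fun k : Fin d → ℤ =>
    ENNReal.ofReal (correlation P X k) • Measure.dirac (latticePoint k)

/-- The `ℤ^d`-periodization `∑_{k ∈ ℤ^d} μ(· - k)` of a measure `μ` on `ℝ^d`. -/
def periodization {d : ℕ} (μ : Measure (EuclideanSpace ℝ (Fin d))) :
    Measure (EuclideanSpace ℝ (Fin d)) :=
  Measure.sum fun k : Fin d → ℤ => μ.map fun x => x + latticePoint k

/-- `μ_p(A) = ∑_k μ(A - k)` for every Borel set `A`. -/
theorem periodization_apply {d : ℕ} (μ : Measure (EuclideanSpace ℝ (Fin d)))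
    {A : Set (EuclideanSpace ℝ (Fin d))} (hA : MeasurableSet A) :
    periodization μ A = ∑' k : Fin d → ℤ, μ ((fun x => x - latticePoint k) '' A) := by
  unfold periodization
  rw [Measure.sum_apply _ hA]
  refine tsum_congr fun k => ?_
  rw [Measure.map_apply (by fun_prop) hA]
  congr 1
  ext x
  constructor
  · intro hx
    exact ⟨x + latticePoint k, hx, by simp⟩
  · rintro ⟨y, hy, rfl⟩
    simpa using hy

/-! ### Autocorrelation and diffraction -/

/-- `γ_R = |B_R|⁻¹ ∑_{x, y ∈ S ∩ B_R} δ_{y - x}`, where `B_R` is the ball of radius `R` centred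
at `0`. -/
def autocorrelationAt {d : ℕ} (S : Set (EuclideanSpace ℝ (Fin d))) (R : ℝ) :
    Measure (EuclideanSpace ℝ (Fin d)) :=
  (volume (Metric.ball (0 : EuclideanSpace ℝ (Fin d)) R))⁻¹ •
    Measure.sum fun p : (S ∩ Metric.ball 0 R : Set (EuclideanSpace ℝ (Fin d))) ×
        (S ∩ Metric.ball 0 R : Set (EuclideanSpace ℝ (Fin d))) =>
      Measure.dirac ((p.2 : EuclideanSpace ℝ (Fin d)) - (p.1 : EuclideanSpace ℝ (Fin d)))

/-- `γ` is the autocorrelation of the locally finite set `S`: a locally finite measure which is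
the limit of the `γ_R` in the vague topology as `R → ∞`. -/
structure IsAutocorrelation {d : ℕ} (S : Set (EuclideanSpace ℝ (Fin d)))
    (γ : Measure (EuclideanSpace ℝ (Fin d))) : Prop where
  finite_inter_ball : ∀ R : ℝ, (S ∩ Metric.ball 0 R).Finite
  isLocallyFinite : IsLocallyFiniteMeasure γ
  tendsto : ∀ f : EuclideanSpace ℝ (Fin d) → ℝ, Continuous f → HasCompactSupport f →
    Tendsto (fun R : ℝ => ∫ x, f x ∂(autocorrelationAt S R)) atTop (𝓝 (∫ x, f x ∂γ))

/-- The measures `γ` and `ν` on `ℝ^d` are tempered and `ν` is the Fourier transform of `γ` in the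
sense of tempered distributions (with the kernel `exp (-2π i ⟨x, y⟩)`). -/
def HasFourierMeasure {d : ℕ} (γ ν : Measure (EuclideanSpace ℝ (Fin d))) : Prop :=
  ∃ (_ : γ.HasTemperateGrowth) (_ : ν.HasTemperateGrowth),
    𝓕 γ.toTemperedDistribution = ν.toTemperedDistribution

/-- `ν` is the diffraction measure of the locally finite set `S`: the Fourier transform of its
autocorrelation. -/
def IsDiffractionMeasure {d : ℕ} (S : Set (EuclideanSpace ℝ (Fin d)))
    (ν : Measure (EuclideanSpace ℝ (Fin d))) : Prop :=
  ∃ γ : Measure (EuclideanSpace ℝ (Fin d)), IsAutocorrelation S γ ∧ HasFourierMeasure γ ν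

end

end LatticeDiffraction

open MeasureTheory LatticeDiffraction

namespace LatticeDiffraction

open MeasureTheory Filter Topology
open scoped FourierTransform SchwartzMap ENNReal

noncomputable section

/-! ### Lattice points in balls, counted by volume. -/

section Lattice

variable {d : ℕ}

/-! The autocorrelation is computed by the ergodic theorem. Since χ lies in `ℤ^d`, the measure `γ_R`
is a sum of point masses at lattice points, and its mass at `k` is the average over `B_R` of `X_i
X_{i+k}`, up to pairs with a point within `‖k‖` of the boundary, which are negligible. Dividing by
`|B_R|` or by the number of lattice points makes no difference in the limit.
`ae_tendsto_ballAverage` gives the limit `E[X₀ X_k]`, simultaneously for the countably many `k`, and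
a compactly supported test function meets only finitely many of them.

That ergodic theorem is convergence on a dense class plus a maximal inequality. Averages of a
bounded coboundary `g - g ∘ shift k` tend to `0`, because only a boundary shell survives the
cancellation. An `L²` function orthogonal to all coboundaries is invariant, hence constant by
ergodicity; so a bounded function minus its mean is an `L²` limit of functions with null averages.
The averages of the small remainder are controlled by Wiener's inequality
`mul_measure_exists_lt_sum_le`, transferred to orbits from a Vitali covering argument on `ℤ^d`.

The diffraction is Poisson summation `hasSum_fourier_mul_character` integrated against `μ`: the
integral of `∑ φ(x + k)` is the pairing of `φ` with the periodization, while that of `∑ 𝓕 φ(k)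
exp(2πi⟨k, x⟩)` is `∑ 𝓕 φ(k) E[X₀ X_k]`, the pairing of `𝓕 φ` with the autocorrelation. -/

@[simp]
theorem latticePoint_apply (k : Fin d → ℤ) (i : Fin d) : latticePoint k i = (k i : ℝ) := rfl

theorem latticePoint_add (j k : Fin d → ℤ) :
    latticePoint (j + k) = latticePoint j + latticePoint k := by
  ext i; simp

theorem latticePoint_sub (j k : Fin d → ℤ) :
    latticePoint (j - k) = latticePoint j - latticePoint k := by
  ext i; simp

@[simp]
theorem latticePoint_zero : latticePoint (0 : Fin d → ℤ) = 0 := by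
  ext i; simp

theorem latticePoint_injective : Function.Injective (latticePoint (d := d)) := by
  intro j k h
  ext i
  have := congrArg (fun x : EuclideanSpace ℝ (Fin d) => x i) h
  simpa using this

/-- The lattice points in the open ball of radius `R` form a finite set. -/
theorem finite_setOf_norm_latticePoint_lt (d : ℕ) (R : ℝ) :
    {k : Fin d → ℤ | ‖latticePoint k‖ < R}.Finite := by
  refine (Set.finite_Icc (fun _ : Fin d => -⌈R⌉) (fun _ => ⌈R⌉)).subset fun k hk => ?_
  have h : ∀ i, |(k i : ℝ)| ≤ ⌈R⌉ := fun i =>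
    ((PiLp.norm_apply_le (latticePoint k) i).trans (le_of_lt hk)).trans (Int.le_ceil R)
  exact ⟨fun i => by exact_mod_cast (abs_le.1 (h i)).1, fun i => by exact_mod_cast (abs_le.1 (h i)).2⟩

/-- The set of the `k ∈ ℤ^d` in the open ball of radius `R` centred at `0`. -/
def latticeBall (d : ℕ) (R : ℝ) : Finset (Fin d → ℤ) :=
  (finite_setOf_norm_latticePoint_lt d R).toFinset

@[simp]
theorem mem_latticeBall {R : ℝ} {k : Fin d → ℤ} : k ∈ latticeBall d R ↔ ‖latticePoint k‖ < R := by
  simp [latticeBall]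

theorem latticeBall_mono {r R : ℝ} (h : r ≤ R) : latticeBall d r ⊆ latticeBall d R := fun _ hk =>
  mem_latticeBall.2 ((mem_latticeBall.1 hk).trans_le h)

/-- The volume of the ball of radius `R` in `ℝ^d`. -/
def ballVolume (d : ℕ) (R : ℝ) : ℝ :=
  volume.real (Metric.ball (0 : EuclideanSpace ℝ (Fin d)) R)

theorem ballVolume_eq {R : ℝ} (hR : 0 < R) : ballVolume d R = R ^ d * ballVolume d 1 := by
  simp only [ballVolume, Measure.real]
  rw [Measure.addHaar_ball_of_pos _ _ hR]
  simp [ENNReal.toReal_ofReal, hR.le]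

theorem ballVolume_pos {R : ℝ} (hR : 0 < R) : 0 < ballVolume d R :=
  ENNReal.toReal_pos (Metric.measure_ball_pos _ _ hR).ne' measure_ball_lt_top.ne

theorem ballVolume_mono {r R : ℝ} (h : r ≤ R) : ballVolume d r ≤ ballVolume d R :=
  ENNReal.toReal_mono measure_ball_lt_top.ne (measure_mono (Metric.ball_subset_ball h))

theorem ballVolume_mul {t R : ℝ} (ht : 0 < t) (hR : 0 < R) :
    ballVolume d (t * R) = t ^ d * ballVolume d R := by
  rw [ballVolume_eq hR, ballVolume_eq (mul_pos ht hR), mul_pow, mul_assoc]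

theorem tendsto_ballVolume_add_div (d : ℕ) (s : ℝ) :
    Tendsto (fun R => ballVolume d (R + s) / ballVolume d R) atTop (𝓝 1) := by
  have h : Tendsto (fun R : ℝ => (1 + s / R) ^ d) atTop (𝓝 1) := by
    have := ((tendsto_const_nhds (x := s)).div_atTop (tendsto_id (α := ℝ))).const_add 1 |>.pow d
    simpa using this
  refine h.congr' ?_
  filter_upwards [eventually_gt_atTop 0, eventually_gt_atTop (-s)] with R hR hRs
  rw [ballVolume_eq hR, ballVolume_eq (by linarith),
    mul_div_mul_right _ _ (ballVolume_pos one_pos).ne', ← div_pow]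
  congr 1
  field_simp

/-- The half-open unit cube with lower corner `k`. -/
def cell (k : Fin d → ℤ) : Set (EuclideanSpace ℝ (Fin d)) :=
  {x | ∀ i, x i ∈ Set.Ioc (k i : ℝ) (k i + 1)}

theorem cell_eq_preimage (k : Fin d → ℤ) :
    cell k = WithLp.ofLp ⁻¹'
      Set.univ.pi fun i => Set.Ioc (k i : ℝ) (k i + 1) := by
  ext x; simp [cell]

theorem measurableSet_cell (k : Fin d → ℤ) : MeasurableSet (cell k) := by
  rw [cell_eq_preimage]
  exact (by fun_prop : Measurable (WithLp.ofLp : EuclideanSpace ℝ (Fin d) → Fin d → ℝ))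
    (MeasurableSet.univ_pi fun i => measurableSet_Ioc)

theorem volume_cell (k : Fin d → ℤ) : volume (cell k) = 1 := by
  rw [cell_eq_preimage, (PiLp.volume_preserving_ofLp (Fin d)).measure_preimage
    (MeasurableSet.univ_pi fun i => measurableSet_Ioc).nullMeasurableSet, volume_pi_pi]
  simp

/-- The cells are open at the lower end, so the index is the ceiling minus one rather than the
floor. Its uniqueness gives disjointness, its existence gives covering. -/
theorem mem_cell_iff {k : Fin d → ℤ} {x : EuclideanSpace ℝ (Fin d)} :
    x ∈ cell k ↔ k = fun i => ⌈x i⌉ - 1 := by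
  simp only [cell, Set.mem_ofPred_eq, Set.mem_Ioc, funext_iff, eq_sub_iff_add_eq]
  refine forall_congr' fun i => ?_
  rw [eq_comm, Int.ceil_eq_iff]
  push_cast
  simp

theorem pairwise_disjoint_cell : Pairwise (Function.onFun Disjoint (cell (d := d))) := by
  intro j k hjk
  refine Set.disjoint_left.2 fun x hj hk => hjk ?_
  rw [mem_cell_iff.1 hj, mem_cell_iff.1 hk]

theorem iUnion_cell : ⋃ k : Fin d → ℤ, cell k = Set.univ :=
  Set.eq_univ_of_forall fun _ => Set.mem_iUnion.2 ⟨_, mem_cell_iff.2 rfl⟩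

theorem add_mem_cell_iff {k : Fin d → ℤ} {x : EuclideanSpace ℝ (Fin d)} :
    x + latticePoint k ∈ cell k ↔ x ∈ cell 0 := by
  simp [cell, add_comm]

theorem norm_sub_latticePoint_lt {k : Fin d → ℤ} {x : EuclideanSpace ℝ (Fin d)} (hx : x ∈ cell k) :
    ‖x - latticePoint k‖ < √d + 1 := by
  -- The bound `√d` is attained at the upper corner of the cell (and when `d = 0`); the extra `1`
  -- buys strictness.
  refine lt_of_le_of_lt ?_ (lt_add_one _)
  rw [EuclideanSpace.norm_eq]
  refine Real.sqrt_le_sqrt ?_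
  calc ∑ i, ‖(x - latticePoint k) i‖ ^ 2 ≤ ∑ _i : Fin d, (1 : ℝ) := by
        refine Finset.sum_le_sum fun i _ => ?_
        have := hx i
        rw [Set.mem_Ioc] at this
        rw [Real.norm_eq_abs, sq_abs]
        simp only [PiLp.sub_apply, latticePoint_apply]
        nlinarith
    _ = d := by simp

/-- Cells have volume one, so counting points is measuring a union of cells, which lies between the
balls of radii `R ± (√d + 1)`. -/
theorem card_latticeBall_eq_volume (R : ℝ) :
    ((latticeBall d R).card : ℝ) = volume.real (⋃ k ∈ latticeBall d R, cell k) := by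
  rw [measureReal_biUnion_finset (fun _ _ _ _ h => pairwise_disjoint_cell h)
    (fun k _ => measurableSet_cell k) (fun _ _ => by simp [volume_cell])]
  simp [Measure.real, volume_cell]

theorem card_latticeBall_le (R : ℝ) :
    ((latticeBall d R).card : ℝ) ≤ ballVolume d (R + (√d + 1)) := by
  rw [card_latticeBall_eq_volume, ballVolume]
  refine measureReal_mono (Set.iUnion₂_subset fun k hk x hx => ?_) measure_ball_lt_top.ne
  rw [mem_latticeBall] at hk
  rw [mem_ball_zero_iff]
  calc ‖x‖ = ‖latticePoint k + (x - latticePoint k)‖ := by simp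
    _ ≤ _ := norm_add_le _ _
    _ < _ := add_lt_add hk (norm_sub_latticePoint_lt hx)

theorem le_card_latticeBall (R : ℝ) :
    ballVolume d (R - (√d + 1)) ≤ (latticeBall d R).card := by
  rw [card_latticeBall_eq_volume, ballVolume]
  refine measureReal_mono (fun x hx => ?_)
    ((measure_biUnion_lt_top (Finset.finite_toSet _) fun k _ => by simp [volume_cell]).ne)
  rw [mem_ball_zero_iff] at hx
  obtain ⟨k, hk⟩ := Set.mem_iUnion.1 (iUnion_cell (d := d).ge (Set.mem_univ x))
  refine Set.mem_iUnion₂.2 ⟨k, ?_, hk⟩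
  rw [mem_latticeBall]
  calc ‖latticePoint k‖ = ‖x - (x - latticePoint k)‖ := by simp
    _ ≤ _ := norm_sub_le _ _
    _ < _ := by linarith [norm_sub_latticePoint_lt hk]

theorem tendsto_card_latticeBall_div (d : ℕ) (s : ℝ) :
    Tendsto (fun R => ((latticeBall d (R + s)).card : ℝ) / ballVolume d R) atTop (𝓝 1) := by
  refine tendsto_of_tendsto_of_tendsto_of_le_of_le'
    (tendsto_ballVolume_add_div d (s - (√d + 1))) (tendsto_ballVolume_add_div d (s + (√d + 1))) ?_ ?_
  · filter_upwards [eventually_gt_atTop 0] with R hR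
    refine div_le_div_of_nonneg_right ?_ (ballVolume_pos hR).le
    rw [← add_sub_assoc]
    exact le_card_latticeBall _
  · filter_upwards [eventually_gt_atTop 0] with R hR
    refine div_le_div_of_nonneg_right ?_ (ballVolume_pos hR).le
    rw [← add_assoc]
    exact card_latticeBall_le _

/-- Balls form a Følner sequence: a boundary shell of fixed width is negligible. This disposes of
every boundary term below. -/
theorem tendsto_card_latticeBall_sub_div (d : ℕ) (s : ℝ) :
    Tendsto (fun R => (((latticeBall d R).card : ℝ) - (latticeBall d (R - s)).card)
      / ballVolume d R) atTop (𝓝 0) := by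
  have := (tendsto_card_latticeBall_div d 0).sub (tendsto_card_latticeBall_div d (-s))
  simpa [sub_div, ← sub_eq_add_neg] using this

/-- Adding finitely many terms to a sum of bounded terms. -/
theorem abs_sum_sub_sum_le {α : Type*} {s t : Finset α} (hst : s ⊆ t) {a : α → ℝ} {C : ℝ}
    (ha : ∀ j, |a j| ≤ C) :
    |∑ j ∈ t, a j - ∑ j ∈ s, a j| ≤ C * ((t.card : ℝ) - s.card) := by
  classical
  rw [← Finset.sum_sdiff hst, add_sub_cancel_right]
  refine (Finset.abs_sum_le_sum_abs _ _).trans ?_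
  refine (Finset.sum_le_card_nsmul _ _ C fun j _ => ha j).trans ?_
  rw [Finset.card_sdiff_of_subset hst, nsmul_eq_mul, Nat.cast_sub (Finset.card_le_card hst), mul_comm]

end Lattice

/-! ### The maximal inequality, on `ℤ^d` and along orbits. -/

section Maximal

variable {d : ℕ}

/-- The constant of the Hardy-Littlewood maximal inequality on `ℤ^d`. -/
def maximalConst (d : ℕ) : ℝ := (4 + (√d + 1)) ^ d

theorem card_latticeBall_four_mul_le {r : ℝ} (hr : 1 ≤ r) :
    ((latticeBall d (4 * r)).card : ℝ) ≤ maximalConst d * ballVolume d r := by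
  have h0 : (0 : ℝ) ≤ √d := Real.sqrt_nonneg _
  refine (card_latticeBall_le _).trans ?_
  rw [maximalConst, ← ballVolume_mul (by positivity) (by linarith)]
  refine ballVolume_mono ?_
  -- Radii are at least `1` so that the additive error `√d + 1` is at most `(√d + 1) * r`.
  nlinarith

/-- The Hardy-Littlewood maximal inequality on `ℤ^d`, for a finite set of points. -/
theorem mul_card_le_of_forall_le_sum (f : (Fin d → ℤ) → ℝ≥0∞) (t : ℝ≥0∞)
    (S T : Finset (Fin d → ℤ)) (r : (Fin d → ℤ) → ℝ) (N : ℝ)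
    (hr : ∀ j ∈ S, 1 ≤ r j) (hrN : ∀ j ∈ S, r j ≤ N)
    (hT : ∀ j ∈ S, ∀ k ∈ latticeBall d N, j + k ∈ T)
    (hf : ∀ j ∈ S, t * ENNReal.ofReal (ballVolume d (r j)) ≤
      ∑ k ∈ latticeBall d (r j), f (j + k)) :
    t * S.card ≤ ENNReal.ofReal (maximalConst d) * ∑ j ∈ T, f j := by
  classical
  -- Vitali: disjoint balls are selected whose fourfold enlargements cover `S`. Disjointness bounds
  -- the sums of `f` by one sum over `T`; covering bounds the cardinality of `S`.
  obtain ⟨u, huS, hdisj, hcov⟩ := Vitali.exists_disjoint_subfamily_covering_enlargement_ball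
    (S : Set (Fin d → ℤ)) latticePoint r N hrN 4 (by norm_num)
  have hu : u.Finite := S.finite_toSet.subset huS
  lift u to Finset (Fin d → ℤ) using hu
  rw [Finset.coe_subset] at huS
  have hsub : S ⊆ u.biUnion fun b => (latticeBall d (4 * r b)).image (b + ·) := by
    intro j hj
    obtain ⟨b, hb, hjb⟩ := hcov j hj
    refine Finset.mem_biUnion.2 ⟨b, hb, Finset.mem_image.2 ⟨j - b, ?_, by abel⟩⟩
    have := hjb (Metric.mem_ball_self (zero_lt_one.trans_le (hr j hj)))
    rwa [mem_latticeBall, latticePoint_sub, ← mem_ball_iff_norm]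
  have hcard : (S.card : ℝ≥0∞) ≤
      ∑ b ∈ u, ENNReal.ofReal (maximalConst d) * ENNReal.ofReal (ballVolume d (r b)) := by
    calc (S.card : ℝ≥0∞) ≤ ((∑ b ∈ u, (latticeBall d (4 * r b)).card : ℕ) : ℝ≥0∞) := by
          exact_mod_cast (Finset.card_le_card hsub).trans (Finset.card_biUnion_le.trans
            (Finset.sum_le_sum fun b _ => Finset.card_image_le))
      _ ≤ _ := by
          rw [Nat.cast_sum]
          refine Finset.sum_le_sum fun b hb => ?_
          rw [← ENNReal.ofReal_mul (by unfold maximalConst; positivity), ← ENNReal.ofReal_natCast]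
          exact ENNReal.ofReal_le_ofReal (card_latticeBall_four_mul_le (hr b (huS hb)))
  calc t * S.card
      ≤ t * ∑ b ∈ u, ENNReal.ofReal (maximalConst d) * ENNReal.ofReal (ballVolume d (r b)) := by
        gcongr
    _ = ENNReal.ofReal (maximalConst d) * ∑ b ∈ u, t * ENNReal.ofReal (ballVolume d (r b)) := by
        rw [Finset.mul_sum, Finset.mul_sum]
        exact Finset.sum_congr rfl fun b _ => by ring
    _ ≤ ENNReal.ofReal (maximalConst d) * ∑ b ∈ u, ∑ k ∈ latticeBall d (r b), f (b + k) := by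
        gcongr with b hb
        exact hf b (huS hb)
    _ = ENNReal.ofReal (maximalConst d) *
          ∑ j ∈ u.biUnion fun b => (latticeBall d (r b)).image (b + ·), f j := by
        rw [Finset.sum_biUnion]
        · congr 1
          refine Finset.sum_congr rfl fun b _ => ?_
          rw [Finset.sum_image fun _ _ _ _ h => add_left_cancel h]
        · intro b hb c hc hbc
          refine Finset.disjoint_left.2 fun j hj hj' => ?_
          obtain ⟨k, hk, rfl⟩ := Finset.mem_image.1 hj
          obtain ⟨l, hl, hkl⟩ := Finset.mem_image.1 hj'
          have h1 : latticePoint (b + k) ∈ Metric.ball (latticePoint b) (r b) := by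
            simpa [mem_ball_iff_norm, latticePoint_add] using hk
          have h2 : latticePoint (b + k) ∈ Metric.ball (latticePoint c) (r c) := by
            rw [← hkl]
            simpa [mem_ball_iff_norm, latticePoint_add] using hl
          exact Set.disjoint_left.1 (hdisj hb hc hbc) h1 h2
    _ ≤ ENNReal.ofReal (maximalConst d) * ∑ j ∈ T, f j := by
        gcongr
        refine Finset.biUnion_subset.2 fun b hb => ?_
        intro j hj
        obtain ⟨k, hk, rfl⟩ := Finset.mem_image.1 hj
        exact hT b (huS hb) k (latticeBall_mono (hrN b (huS hb)) hk)

theorem measurable_shift (k : Fin d → ℤ) : Measurable (shift k) :=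
  measurable_pi_lambda _ fun j => measurable_pi_apply (j + k)

theorem shift_shift (j k : Fin d → ℤ) (x : (Fin d → ℤ) → ℝ) :
    shift j (shift k x) = shift (j + k) x := by
  ext i; simp [shift, add_assoc]

theorem shift_comp_shift (j k : Fin d → ℤ) : shift j ∘ shift k = shift (j + k) :=
  funext (shift_shift j k)

@[simp]
theorem shift_zero : shift (0 : Fin d → ℤ) = id := by
  ext x i; simp [shift]

variable {ν : Measure ((Fin d → ℤ) → ℝ)}

theorem measurable_sum_shift {g : ((Fin d → ℤ) → ℝ) → ℝ≥0∞} (hg : Measurable g)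
    (s : Finset (Fin d → ℤ)) : Measurable fun y => ∑ k ∈ s, g (shift k y) :=
  Finset.measurable_sum _ fun k _ => hg.comp (measurable_shift k)

theorem lintegral_sum_shift (hν : ∀ k, MeasurePreserving (shift k) ν ν)
    {g : ((Fin d → ℤ) → ℝ) → ℝ≥0∞} (hg : Measurable g) (s : Finset (Fin d → ℤ)) :
    ∫⁻ y, ∑ k ∈ s, g (shift k y) ∂ν = s.card * ∫⁻ y, g y ∂ν := by
  rw [lintegral_finsetSum (f := fun k y => g (shift k y)) _
    fun k _ => hg.comp (measurable_shift k)]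
  simp [(hν _).lintegral_comp hg]

/-- The set of trajectories for which an average of `g` over a ball of integer radius at most `N`
is at least `t`. -/
def maximalSet (g : ((Fin d → ℤ) → ℝ) → ℝ≥0∞) (t : ℝ≥0∞) (N : ℕ) : Set ((Fin d → ℤ) → ℝ) :=
  {y | ∃ n : ℕ, 1 ≤ n ∧ n ≤ N ∧
    t * ENNReal.ofReal (ballVolume d n) ≤ ∑ k ∈ latticeBall d n, g (shift k y)}

theorem measurableSet_maximalSet {g : ((Fin d → ℤ) → ℝ) → ℝ≥0∞} (hg : Measurable g) (t : ℝ≥0∞)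
    (N : ℕ) : MeasurableSet (maximalSet g t N) := by
  have : maximalSet g t N = ⋃ n ∈ Set.Icc 1 N, {y | t * ENNReal.ofReal (ballVolume d n) ≤
      ∑ k ∈ latticeBall d n, g (shift k y)} := by
    ext y; simp [maximalSet, and_assoc]
  rw [this]
  exact MeasurableSet.biUnion (Set.to_countable _) fun n _ =>
    measurableSet_le measurable_const (measurable_sum_shift hg _)

theorem monotone_maximalSet (g : ((Fin d → ℤ) → ℝ) → ℝ≥0∞) (t : ℝ≥0∞) :
    Monotone (maximalSet g t) := fun _ _ hNM _ ⟨n, h1, h2, h3⟩ => ⟨n, h1, h2.trans hNM, h3⟩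

/-- Transference: the deterministic inequality is applied to `k ↦ g (shift k y)` on a large ball for
each fixed `y`, then integrated; by stationarity every translate contributes the same integral. -/
theorem mul_card_mul_measure_maximalSet_le (hν : ∀ k, MeasurePreserving (shift k) ν ν)
    {g : ((Fin d → ℤ) → ℝ) → ℝ≥0∞} (hg : Measurable g) (t : ℝ≥0∞) (N : ℕ) (R : ℝ) :
    t * ((latticeBall d R).card * ν (maximalSet g t N)) ≤
      ENNReal.ofReal (maximalConst d) * ((latticeBall d (R + N)).card * ∫⁻ y, g y ∂ν) := by
  classical
  have hM := measurableSet_maximalSet hg t N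
  have h1 : Measurable ((maximalSet g t N).indicator (1 : ((Fin d → ℤ) → ℝ) → ℝ≥0∞)) :=
    measurable_one.indicator hM
  calc t * ((latticeBall d R).card * ν (maximalSet g t N))
      = ∫⁻ y, t * ∑ k ∈ latticeBall d R, (maximalSet g t N).indicator 1 (shift k y) ∂ν := by
        rw [lintegral_const_mul _ (measurable_sum_shift h1 _), lintegral_sum_shift hν h1,
          lintegral_indicator_one hM]
    _ ≤ ∫⁻ y, ENNReal.ofReal (maximalConst d) *
          ∑ k ∈ latticeBall d (R + N), g (shift k y) ∂ν := by
        refine lintegral_mono fun y => ?_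
        have hsum : ∑ k ∈ latticeBall d R, (maximalSet g t N).indicator 1 (shift k y) =
            (((latticeBall d R).filter fun k => shift k y ∈ maximalSet g t N).card : ℝ≥0∞) := by
          rw [Finset.card_filter, Nat.cast_sum]
          exact Finset.sum_congr rfl fun k _ => by simp [Set.indicator_apply]
        dsimp only
        rw [hsum]
        -- A radius is chosen for every `k`; the value `0` outside the maximal set is never used.
        have hex : ∀ k, ∃ n : ℕ, shift k y ∈ maximalSet g t N → 1 ≤ n ∧ n ≤ N ∧
            t * ENNReal.ofReal (ballVolume d n) ≤
              ∑ j ∈ latticeBall d n, g (shift j (shift k y)) := fun k => by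
          by_cases hk : shift k y ∈ maximalSet g t N
          · obtain ⟨n, hn⟩ := hk
            exact ⟨n, fun _ => hn⟩
          · exact ⟨0, fun h => absurd h hk⟩
        choose n hn using hex
        refine mul_card_le_of_forall_le_sum (fun k => g (shift k y)) t _ _ (fun k => n k) N ?_ ?_ ?_ ?_
        · intro j hj
          exact_mod_cast (hn j (Finset.mem_filter.1 hj).2).1
        · intro j hj
          exact_mod_cast (hn j (Finset.mem_filter.1 hj).2).2.1
        · intro j hj k hk
          rw [mem_latticeBall] at hk ⊢
          rw [latticePoint_add]
          exact (norm_add_le _ _).trans_lt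
            (add_lt_add (mem_latticeBall.1 (Finset.mem_filter.1 hj).1) hk)
        · intro j hj
          refine (hn j (Finset.mem_filter.1 hj).2).2.2.trans_eq
            (Finset.sum_congr rfl fun k _ => ?_)
          rw [shift_shift, add_comm]
    _ = _ := by
        rw [lintegral_const_mul _ (measurable_sum_shift hg _), lintegral_sum_shift hν hg]

theorem tendsto_ofReal_card_latticeBall_div (s : ℝ) :
    Tendsto (fun R => ((latticeBall d (R + s)).card : ℝ≥0∞) * ENNReal.ofReal (ballVolume d R)⁻¹)
      atTop (𝓝 1) := by
  have := (ENNReal.continuous_ofReal.tendsto 1).comp (tendsto_card_latticeBall_div d s)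
  rw [ENNReal.ofReal_one] at this
  refine this.congr fun R => ?_
  simp only [Function.comp]
  rw [div_eq_mul_inv, ENNReal.ofReal_mul (by positivity), ENNReal.ofReal_natCast]

/-- With `N` fixed and `R → ∞`, enlarging the ball from `R` to `R + N` costs nothing after division
by the volume. -/
theorem mul_measure_maximalSet_le (hν : ∀ k, MeasurePreserving (shift k) ν ν)
    {g : ((Fin d → ℤ) → ℝ) → ℝ≥0∞} (hg : Measurable g) (t : ℝ≥0∞) (N : ℕ) :
    t * ν (maximalSet g t N) ≤ ENNReal.ofReal (maximalConst d) * ∫⁻ y, g y ∂ν := by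
  have hl : Tendsto (fun R => (t * ν (maximalSet g t N)) * (((latticeBall d (R + 0)).card : ℝ≥0∞) *
      ENNReal.ofReal (ballVolume d R)⁻¹)) atTop (𝓝 (t * ν (maximalSet g t N) * 1)) :=
    ENNReal.Tendsto.const_mul (tendsto_ofReal_card_latticeBall_div 0) (Or.inl one_ne_zero)
  have hr : Tendsto (fun R => (ENNReal.ofReal (maximalConst d) * ∫⁻ y, g y ∂ν) *
      (((latticeBall d (R + N)).card : ℝ≥0∞) * ENNReal.ofReal (ballVolume d R)⁻¹)) atTop
      (𝓝 ((ENNReal.ofReal (maximalConst d) * ∫⁻ y, g y ∂ν) * 1)) :=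
    ENNReal.Tendsto.const_mul (tendsto_ofReal_card_latticeBall_div N) (Or.inl one_ne_zero)
  rw [mul_one] at hl hr
  refine le_of_tendsto_of_tendsto' hl hr fun R => ?_
  have h := mul_card_mul_measure_maximalSet_le hν hg t N R
  calc _ = t * ((latticeBall d R).card * ν (maximalSet g t N)) *
          ENNReal.ofReal (ballVolume d R)⁻¹ := by rw [add_zero]; ring
    _ ≤ _ := mul_le_mul_left h _
    _ = _ := by ring

/-- Wiener's maximal inequality for the averages of a stationary process over balls. -/
theorem mul_measure_exists_lt_sum_le (hν : ∀ k, MeasurePreserving (shift k) ν ν)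
    {g : ((Fin d → ℤ) → ℝ) → ℝ≥0∞} (hg : Measurable g) (t : ℝ≥0∞) :
    t * ν {y | ∃ R : ℝ, 1 ≤ R ∧
        2 ^ d * t * ENNReal.ofReal (ballVolume d R) ≤ ∑ k ∈ latticeBall d R, g (shift k y)} ≤
      ENNReal.ofReal (maximalConst d) * ∫⁻ y, g y ∂ν := by
  have hsub : {y | ∃ R : ℝ, 1 ≤ R ∧ 2 ^ d * t * ENNReal.ofReal (ballVolume d R) ≤
      ∑ k ∈ latticeBall d R, g (shift k y)} ⊆ ⋃ N, maximalSet g t N := by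
    rintro y ⟨R, hR, hy⟩
    refine Set.mem_iUnion.2 ⟨⌈R⌉₊, ⌈R⌉₊, Nat.one_le_ceil_iff.2 (by linarith), le_rfl, ?_⟩
    -- Since `R ≥ 1`, rounding up at most doubles the radius; this is the source of the factor `2 ^
    -- d`.
    calc t * ENNReal.ofReal (ballVolume d ⌈R⌉₊)
        ≤ t * ENNReal.ofReal (ballVolume d (2 * R)) := by
          gcongr
          refine ballVolume_mono ?_
          linarith [Nat.ceil_lt_add_one (zero_le_one.trans hR)]
      _ = 2 ^ d * t * ENNReal.ofReal (ballVolume d R) := by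
          rw [ballVolume_mul two_pos (by linarith), ENNReal.ofReal_mul (by positivity),
            ENNReal.ofReal_pow two_pos.le, ENNReal.ofReal_ofNat]
          ring
      _ ≤ _ := hy
      _ ≤ _ := Finset.sum_le_sum_of_subset (latticeBall_mono (Nat.le_ceil R))
  refine (mul_le_mul_right (measure_mono hsub) t).trans ?_
  rw [(monotone_maximalSet g t).measure_iUnion, ENNReal.mul_iSup]
  exact iSup_le fun N => mul_measure_maximalSet_le hν hg t N

end Maximal

/-! ### The pointwise ergodic theorem over balls. -/

section Ergodic

variable {d : ℕ}

/-- The average of `f` along the orbit of `y`, over the ball of radius `R`. -/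
def ballAverage (f : ((Fin d → ℤ) → ℝ) → ℝ) (R : ℝ) (y : (Fin d → ℤ) → ℝ) : ℝ :=
  (∑ k ∈ latticeBall d R, f (shift k y)) / ballVolume d R

theorem ballAverage_add (f g : ((Fin d → ℤ) → ℝ) → ℝ) (R : ℝ) (y : (Fin d → ℤ) → ℝ) :
    ballAverage (f + g) R y = ballAverage f R y + ballAverage g R y := by
  simp [ballAverage, Finset.sum_add_distrib, add_div]

theorem ballAverage_smul (c : ℝ) (f : ((Fin d → ℤ) → ℝ) → ℝ) (R : ℝ) (y : (Fin d → ℤ) → ℝ) :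
    ballAverage (c • f) R y = c * ballAverage f R y := by
  simp [ballAverage, ← Finset.mul_sum, mul_div_assoc]

theorem tendsto_ballAverage_const (c : ℝ) (y : (Fin d → ℤ) → ℝ) :
    Tendsto (fun R => ballAverage (fun _ => c) R y) atTop (𝓝 c) := by
  have := (tendsto_card_latticeBall_div d 0).mul_const c
  rw [one_mul] at this
  refine this.congr fun R => ?_
  simp [ballAverage, mul_div_right_comm]

/-- The averages of a bounded coboundary tend to `0`. -/
theorem tendsto_ballAverage_sub_comp_shift {g : ((Fin d → ℤ) → ℝ) → ℝ} {C : ℝ}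
    (hg : ∀ y, |g y| ≤ C) (k : Fin d → ℤ) (y : (Fin d → ℤ) → ℝ) :
    Tendsto (fun R => ballAverage (g - g ∘ shift k) R y) atTop (𝓝 0) := by
  classical
  have hlim := (tendsto_card_latticeBall_sub_div d ‖latticePoint k‖).const_mul (2 * C)
  rw [mul_zero] at hlim
  refine squeeze_zero_norm' ?_ hlim
  filter_upwards [eventually_gt_atTop 0] with R hR
  set a : (Fin d → ℤ) → ℝ := fun j => g (shift j y) with ha
  have ha' : ∀ j, |a j| ≤ C := fun j => hg _
  have h1 : latticeBall d (R - ‖latticePoint k‖) ⊆ latticeBall d R :=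
    latticeBall_mono (sub_le_self _ (norm_nonneg _))
  have h2 : latticeBall d (R - ‖latticePoint k‖) ⊆ (latticeBall d R).image (k + ·) := by
    intro j hj
    refine Finset.mem_image.2 ⟨j - k, ?_, by abel⟩
    rw [mem_latticeBall] at hj ⊢
    rw [latticePoint_sub]
    linarith [norm_sub_le (latticePoint j) (latticePoint k)]
  -- The ball and its translate by `k` both contain the ball of radius `R - ‖k‖`; comparing each sum
  -- with the sum over this common part gives the constant `2 * C`.
  have e1 := abs_sum_sub_sum_le h1 ha'
  have e2 := abs_sum_sub_sum_le h2 ha'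
  rw [Finset.card_image_of_injective _ (add_right_injective k),
    Finset.sum_image fun _ _ _ _ h => add_left_cancel h] at e2
  have hsum : ∑ j ∈ latticeBall d R, (g - g ∘ shift k) (shift j y) =
      ∑ j ∈ latticeBall d R, a j - ∑ j ∈ latticeBall d R, a (k + j) := by
    rw [← Finset.sum_sub_distrib]
    refine Finset.sum_congr rfl fun j _ => ?_
    simp [ha, shift_shift]
  rw [ballAverage, hsum, norm_div, Real.norm_eq_abs, Real.norm_eq_abs,
    abs_of_pos (ballVolume_pos hR), ← mul_div_assoc]
  refine div_le_div_of_nonneg_right ?_ (ballVolume_pos hR).le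
  rw [abs_le] at *
  constructor <;> linarith [e1.1, e1.2, e2.1, e2.2]

variable {ν : Measure ((Fin d → ℤ) → ℝ)}

/-- The classes in `L²` of the bounded measurable functions all of whose averages over large balls
tend to `0`. -/
def nullAverages (ν : Measure ((Fin d → ℤ) → ℝ)) : Submodule ℝ (Lp ℝ 2 ν) where
  carrier := {φ | ∃ h : ((Fin d → ℤ) → ℝ) → ℝ, Measurable h ∧ (∃ C, ∀ y, |h y| ≤ C) ∧
    (∀ y, Tendsto (fun R => ballAverage h R y) atTop (𝓝 0)) ∧ φ =ᵐ[ν] h}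
  zero_mem' := ⟨0, measurable_zero, ⟨0, by simp⟩, fun y => by simp [ballAverage], Lp.coeFn_zero _ _ _⟩
  add_mem' := by
    rintro φ ψ ⟨f, hf, ⟨C, hC⟩, hlf, hφ⟩ ⟨g, hg, ⟨D, hD⟩, hlg, hψ⟩
    refine ⟨f + g, hf.add hg, ⟨C + D, fun y => (abs_add_le _ _).trans (add_le_add (hC y) (hD y))⟩,
      fun y => ?_, (Lp.coeFn_add φ ψ).trans (hφ.add hψ)⟩
    simpa [ballAverage_add] using (hlf y).add (hlg y)
  smul_mem' := by
    rintro c φ ⟨f, hf, ⟨C, hC⟩, hlf, hφ⟩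
    refine ⟨c • f, hf.const_smul c, ⟨|c| * C, fun y => ?_⟩, fun y => ?_,
      (Lp.coeFn_smul c φ).trans (hφ.const_smul c)⟩
    · rw [Pi.smul_apply, smul_eq_mul, abs_mul]
      exact mul_le_mul_of_nonneg_left (hC y) (abs_nonneg c)
    · simpa [ballAverage_smul] using (hlf y).const_mul c

/-- An `L²` function which is orthogonal to all the bounded coboundaries is invariant. -/
theorem comp_shift_ae_eq_of_mem_orthogonal [IsFiniteMeasure ν]
    (hν : ∀ k, MeasurePreserving (shift k) ν ν) {w : Lp ℝ 2 ν} (hw : w ∈ (nullAverages ν)ᗮ)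
    (k : Fin d → ℤ) : w ∘ shift k =ᵐ[ν] w := by
  have hwi : Integrable w ν := (Lp.memLp w).integrable one_le_two
  -- Testing `w` against the coboundary of the indicator of `A` shows that `A` and its preimage
  -- carry the same integral of `w`.
  have key : ∀ A, MeasurableSet A → ∫ y in A, w y ∂ν = ∫ y in shift k ⁻¹' A, w y ∂ν := by
    intro A hA
    set g : ((Fin d → ℤ) → ℝ) → ℝ := A.indicator 1 with hgdef
    have hgm : Measurable g := measurable_one.indicator hA
    have hgb : ∀ y, |g y| ≤ 1 := fun y => by
      by_cases hy : y ∈ A <;> simp [hgdef, hy]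
    have hm : Measurable (g - g ∘ shift k) := hgm.sub (hgm.comp (measurable_shift k))
    have hb : ∀ y, |(g - g ∘ shift k) y| ≤ 2 := fun y => by
      refine (abs_sub _ _).trans ?_
      have h2 : |(g ∘ shift k) y| ≤ 1 := hgb (shift k y)
      linarith [hgb y]
    have hL : MemLp (g - g ∘ shift k) 2 ν :=
      MemLp.of_bound hm.aestronglyMeasurable 2 (Eventually.of_forall hb)
    have hmem : hL.toLp ∈ nullAverages ν :=
      ⟨_, hm, ⟨2, hb⟩, tendsto_ballAverage_sub_comp_shift hgb k, hL.coeFn_toLp⟩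
    have h0 := Submodule.inner_right_of_mem_orthogonal hmem hw
    rw [L2.inner_def] at h0
    have h1 : ∫ y, (A.indicator w y - (shift k ⁻¹' A).indicator w y) ∂ν = 0 := by
      rw [← h0]
      refine integral_congr_ae ?_
      filter_upwards [hL.coeFn_toLp] with y hy
      rw [hy]
      by_cases h1 : y ∈ A <;> by_cases h2 : shift k y ∈ A <;> simp [hgdef, h1, h2]
    rw [integral_sub (hwi.indicator hA) (hwi.indicator (measurable_shift k hA)),
      integral_indicator hA, integral_indicator (measurable_shift k hA)] at h1
    linarith
  refine Integrable.ae_eq_of_forall_setIntegral_eq _ _ ((hν k).integrable_comp_of_integrable hwi) hwi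
    fun B hB _ => ?_
  -- Shifts are invertible, so every measurable set is a preimage, to which both `key` and the
  -- change of variables apply.
  have hB' : B = shift k ⁻¹' (shift (-k) ⁻¹' B) := by
    rw [← Set.preimage_comp, shift_comp_shift]; simp
  have hA := measurable_shift (-k) hB
  have hset : ∀ v : ((Fin d → ℤ) → ℝ) → ℝ, AEStronglyMeasurable v ν →
      ∫ y in shift (-k) ⁻¹' B, v y ∂ν = ∫ y in shift k ⁻¹' (shift (-k) ⁻¹' B), v (shift k y) ∂ν := by
    intro v hv
    conv_lhs => rw [← (hν k).map_eq]
    exact setIntegral_map hA (by rwa [(hν k).map_eq]) (measurable_shift k).aemeasurable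
  rw [hB', ← key _ hA]
  exact (hset w (Lp.aestronglyMeasurable w)).symm

/-- Ergodicity concerns strictly invariant sets, whereas `w` is invariant only almost everywhere.
Intersecting all translates of `w ⁻¹' U` gives a strictly invariant set, which differs from it by a
null set because `ℤ^d` is countable. -/
theorem exists_ae_eq_const_of_comp_shift_ae_eq [IsProbabilityMeasure ν]
    (herg : ∀ A : Set ((Fin d → ℤ) → ℝ), MeasurableSet A → (∀ k, shift k ⁻¹' A = A) →
      ν A = 0 ∨ ν A = 1)
    {w : ((Fin d → ℤ) → ℝ) → ℝ} (hwm : Measurable w) (hw : ∀ k, w ∘ shift k =ᵐ[ν] w) :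
    ∃ c : ℝ, w =ᵐ[ν] fun _ => c := by
  refine exists_eventuallyEq_const_of_forall_separating MeasurableSet fun U hU => ?_
  set A := w ⁻¹' U with hA
  have hAm : MeasurableSet A := hwm hU
  set B := ⋂ k, shift k ⁻¹' A with hB
  have hBm : MeasurableSet B := MeasurableSet.iInter fun k => measurable_shift k hAm
  have hBinv : ∀ k, shift k ⁻¹' B = B := fun j => by
    ext y
    simp only [hB, Set.mem_preimage, Set.mem_iInter, shift_shift]
    exact ⟨fun h k => by simpa using h (k - j), fun h k => h (k + j)⟩
  have hae : ∀ᵐ y ∂ν, (y ∈ B ↔ y ∈ A) := by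
    filter_upwards [ae_all_iff.2 hw] with y hy
    simp only [hB, hA, Set.mem_iInter, Set.mem_preimage]
    refine ⟨fun h => by simpa using h 0, fun h k => ?_⟩
    rw [show w (shift k y) = w y from hy k]
    exact h
  rcases herg B hBm hBinv with h | h
  · right
    filter_upwards [hae, measure_eq_zero_iff_ae_notMem.1 h] with y h1 h2
    exact fun h3 => h2 (h1.2 h3)
  · left
    filter_upwards [hae, (mem_ae_iff_prob_eq_one hBm).2 h] with y h1 h2
    exact h1.1 h2

/-- A bounded function is the sum of its mean, of a function with null averages, and of a function
which is small in mean. -/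
theorem exists_null_averages_lintegral_sub_lt [IsProbabilityMeasure ν]
    (hν : ∀ k, MeasurePreserving (shift k) ν ν)
    (herg : ∀ A : Set ((Fin d → ℤ) → ℝ), MeasurableSet A → (∀ k, shift k ⁻¹' A = A) →
      ν A = 0 ∨ ν A = 1)
    {f : ((Fin d → ℤ) → ℝ) → ℝ} (hf : Measurable f) {C : ℝ} (hC : ∀ y, |f y| ≤ C)
    {ε : ℝ} (hε : 0 < ε) :
    ∃ h : ((Fin d → ℤ) → ℝ) → ℝ, Measurable h ∧
      (∀ y, Tendsto (fun R => ballAverage h R y) atTop (𝓝 0)) ∧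
      ∫⁻ y, ‖f y - ∫ z, f z ∂ν - h y‖ₑ ∂ν ≤ ENNReal.ofReal ε := by
  set c := ∫ z, f z ∂ν with hc
  have hfL : MemLp f 2 ν := MemLp.of_bound hf.aestronglyMeasurable C (Eventually.of_forall hC)
  have hfi : Integrable f ν := hfL.integrable one_le_two
  have hL : MemLp (fun y => f y - c) 2 ν := hfL.sub (memLp_const c)
  have hmem : hL.toLp ∈ (nullAverages ν).topologicalClosure := by
    -- Membership in the closure is orthogonality to the orthogonal complement, whose elements are
    -- constants; `f - c` has mean zero.
    rw [← Submodule.orthogonal_orthogonal_eq_closure, Submodule.mem_orthogonal]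
    intro w hw
    obtain ⟨b, hb⟩ := exists_ae_eq_const_of_comp_shift_ae_eq herg (Lp.stronglyMeasurable w).measurable
      (comp_shift_ae_eq_of_mem_orthogonal hν hw)
    rw [L2.inner_def]
    have : ∫ y, inner ℝ (w y) (hL.toLp _ y) ∂ν = ∫ y, (f y - c) * b ∂ν := by
      refine integral_congr_ae ?_
      filter_upwards [hb, hL.coeFn_toLp] with y h1 h2
      rw [h1, h2]
      rfl
    rw [this, integral_mul_const, integral_sub hfi (integrable_const c)]
    simp [hc]
  obtain ⟨φ, ⟨h, hm, -, hlim, hφ⟩, hdist⟩ := Metric.mem_closure_iff.1 hmem ε hε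
  refine ⟨h, hm, hlim, ?_⟩
  calc ∫⁻ y, ‖f y - c - h y‖ₑ ∂ν = eLpNorm (fun y => f y - c - h y) 1 ν :=
        eLpNorm_one_eq_lintegral_enorm.symm
    _ ≤ eLpNorm (fun y => f y - c - h y) 2 ν :=
        eLpNorm_le_eLpNorm_of_exponent_le one_le_two
          ((hf.sub_const c).sub hm).aestronglyMeasurable
    _ = eLpNorm (⇑(hL.toLp _) - ⇑φ) 2 ν := by
        refine eLpNorm_congr_ae ?_
        filter_upwards [hφ, hL.coeFn_toLp] with y h1 h2
        simp [h1, h2]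
    _ = edist (hL.toLp _) φ := (Lp.edist_def _ _).symm
    _ ≤ ENNReal.ofReal ε := by
        rw [edist_dist]
        exact ENNReal.ofReal_le_ofReal hdist.le

/-- The pointwise ergodic theorem for the averages over balls of a bounded function. -/
theorem ae_tendsto_ballAverage [IsProbabilityMeasure ν]
    (hν : ∀ k, MeasurePreserving (shift k) ν ν)
    (herg : ∀ A : Set ((Fin d → ℤ) → ℝ), MeasurableSet A → (∀ k, shift k ⁻¹' A = A) →
      ν A = 0 ∨ ν A = 1)
    {f : ((Fin d → ℤ) → ℝ) → ℝ} (hf : Measurable f) {C : ℝ} (hC : ∀ y, |f y| ≤ C) :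
    ∀ᵐ y ∂ν, Tendsto (fun R => ballAverage f R y) atTop (𝓝 (∫ z, f z ∂ν)) := by
  set c := ∫ z, f z ∂ν with hc
  -- In the threshold, `2 ^ d * s` is left to the maximal inequality and `s` absorbs the function
  -- with null averages. The exceptional set does not depend on the approximation error `ε`, which
  -- can then tend to `0`.
  have key : ∀ s : ℝ, 0 < s →
      ν {y | ∃ᶠ R in atTop, 2 ^ d * s + s < |ballAverage (fun y => f y - c) R y|} = 0 := by
    intro s hs
    set B := {y | ∃ᶠ R in atTop, 2 ^ d * s + s < |ballAverage (fun y => f y - c) R y|} with hB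
    have hbound : ∀ ε : ℝ, 0 < ε →
        ENNReal.ofReal s * ν B ≤ ENNReal.ofReal (maximalConst d * ε) := by
      intro ε hε
      obtain ⟨h, hm, hlim, hint⟩ := exists_null_averages_lintegral_sub_lt hν herg hf hC hε
      have hmax := mul_measure_exists_lt_sum_le hν
        ((hf.sub_const c).sub hm).enorm (ENNReal.ofReal s)
      rw [ENNReal.ofReal_mul (by unfold maximalConst; positivity)]
      refine le_trans ?_ (hmax.trans (mul_le_mul_right hint _))
      refine mul_le_mul_right (measure_mono fun y hy => ?_) _
      have hev : ∀ᶠ R in atTop, |ballAverage h R y| < s := by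
        simpa [Real.dist_eq] using (Metric.tendsto_nhds.1 (hlim y)) s hs
      obtain ⟨R, hR1, hR2, hR3⟩ := (Frequently.and_eventually hy
        (hev.and (eventually_ge_atTop 1))).exists
      refine ⟨R, hR3, ?_⟩
      have hV := ballVolume_pos (d := d) (zero_lt_one.trans_le hR3)
      have hsplit : ballAverage (fun y => f y - c) R y =
          ballAverage (fun y => f y - c - h y) R y + ballAverage h R y := by
        rw [← ballAverage_add]
        congr 1
        ext z
        simp
      have h1 : 2 ^ d * s < |ballAverage (fun y => f y - c - h y) R y| := by
        have := abs_add_le (ballAverage (fun y => f y - c - h y) R y) (ballAverage h R y)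
        rw [← hsplit] at this
        linarith
      have h2 : 2 ^ d * s * ballVolume d R ≤
          ∑ k ∈ latticeBall d R, |f (shift k y) - c - h (shift k y)| := by
        rw [ballAverage, abs_div, abs_of_pos hV, lt_div_iff₀ hV] at h1
        exact h1.le.trans (Finset.abs_sum_le_sum_abs _ _)
      calc 2 ^ d * ENNReal.ofReal s * ENNReal.ofReal (ballVolume d R)
          = ENNReal.ofReal (2 ^ d * s * ballVolume d R) := by
            rw [ENNReal.ofReal_mul (by positivity), ENNReal.ofReal_mul (by positivity),
              ENNReal.ofReal_pow two_pos.le, ENNReal.ofReal_ofNat]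
        _ ≤ ENNReal.ofReal (∑ k ∈ latticeBall d R, |f (shift k y) - c - h (shift k y)|) :=
            ENNReal.ofReal_le_ofReal h2
        _ = _ := by
            rw [ENNReal.ofReal_sum_of_nonneg fun _ _ => abs_nonneg _]
            simp [Real.enorm_eq_ofReal_abs]
    have h0 : ENNReal.ofReal s * ν B ≤ 0 := by
      have hl : Tendsto (fun ε : ℝ => ENNReal.ofReal (maximalConst d * ε)) (𝓝[>] 0) (𝓝 0) := by
        have : Continuous fun ε : ℝ => ENNReal.ofReal (maximalConst d * ε) :=
          ENNReal.continuous_ofReal.comp (by fun_prop)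
        simpa using (this.tendsto 0).mono_left nhdsWithin_le_nhds
      exact ge_of_tendsto hl (by filter_upwards [self_mem_nhdsWithin] with ε hε using hbound ε hε)
    simpa [hs.not_ge] using h0
  have hall : ∀ᵐ y ∂ν, ∀ n : ℕ, ¬ ∃ᶠ R in atTop,
      2 ^ d * (1 / ((n : ℝ) + 1)) + 1 / ((n : ℝ) + 1) < |ballAverage (fun y => f y - c) R y| :=
    ae_all_iff.2 fun n => measure_eq_zero_iff_ae_notMem.1 (key _ (by positivity))
  filter_upwards [hall] with y hy
  have h0 : Tendsto (fun R => ballAverage (fun y => f y - c) R y) atTop (𝓝 0) := by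
    refine Metric.tendsto_nhds.2 fun δ hδ => ?_
    have hl : Tendsto (fun n : ℕ => 2 ^ d * (1 / ((n : ℝ) + 1)) + 1 / ((n : ℝ) + 1)) atTop (𝓝 0) := by
      simpa using (tendsto_one_div_add_atTop_nhds_zero_nat (𝕜 := ℝ)).const_mul (2 ^ d) |>.add
        (tendsto_one_div_add_atTop_nhds_zero_nat (𝕜 := ℝ))
    obtain ⟨n, hn⟩ := (hl.eventually_lt_const hδ).exists
    filter_upwards [not_frequently.1 (hy n)] with R hR
    rw [Real.dist_eq, sub_zero]
    exact (not_lt.1 hR).trans_lt hn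
  have := h0.add (tendsto_ballAverage_const c y)
  rw [zero_add] at this
  refine this.congr fun R => ?_
  rw [← ballAverage_add]
  congr 1
  ext z
  simp

end Ergodic

/-! ### From pair densities to the autocorrelation. -/

section Autocorrelation

variable {d : ℕ}

theorem exists_finset_of_hasCompactSupport {f : EuclideanSpace ℝ (Fin d) → ℝ}
    (hf : HasCompactSupport f) : ∃ K : Finset (Fin d → ℤ), ∀ k, k ∉ K → f (latticePoint k) = 0 := by
  obtain ⟨R, hR⟩ := hf.isBounded.subset_ball 0
  refine ⟨latticeBall d R, fun k hk => by_contra fun h => hk ?_⟩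
  rw [mem_latticeBall, ← mem_ball_zero_iff]
  exact hR (subset_tsupport f h)

theorem mem_image_latticePoint_inter_ball_iff {Z : Set (Fin d → ℤ)} [DecidablePred (· ∈ Z)] {R : ℝ}
    [DecidableEq (EuclideanSpace ℝ (Fin d))] (x : EuclideanSpace ℝ (Fin d)) :
    x ∈ ((latticeBall d R).filter (· ∈ Z)).image latticePoint ↔
      x ∈ latticePoint '' Z ∩ Metric.ball 0 R := by
  simp only [Finset.mem_image, Finset.mem_filter, mem_latticeBall, Set.mem_inter_iff, Set.mem_image,
    mem_ball_zero_iff]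
  constructor
  · rintro ⟨k, ⟨h1, h2⟩, rfl⟩
    exact ⟨⟨k, h2, rfl⟩, h1⟩
  · rintro ⟨⟨k, h2, rfl⟩, h1⟩
    exact ⟨k, ⟨h1, h2⟩, rfl⟩

theorem integral_autocorrelationAt_image_latticePoint (Z : Set (Fin d → ℤ)) [DecidablePred (· ∈ Z)]
    (f : EuclideanSpace ℝ (Fin d) → ℝ) (R : ℝ) :
    ∫ x, f x ∂(autocorrelationAt (latticePoint '' Z) R) = (ballVolume d R)⁻¹ *
      ∑ i ∈ (latticeBall d R).filter (· ∈ Z), ∑ j ∈ (latticeBall d R).filter (· ∈ Z),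
        f (latticePoint (j - i)) := by
  classical
  have hmem := mem_image_latticePoint_inter_ball_iff (Z := Z) (R := R)
  have : Fintype (latticePoint '' Z ∩ Metric.ball 0 R : Set (EuclideanSpace ℝ (Fin d))) :=
    Fintype.ofFinset _ hmem
  have hsum : ∀ g : EuclideanSpace ℝ (Fin d) → ℝ,
      ∑ x : (latticePoint '' Z ∩ Metric.ball 0 R : Set (EuclideanSpace ℝ (Fin d))), g x =
        ∑ k ∈ (latticeBall d R).filter (· ∈ Z), g (latticePoint k) := fun g => by
    rw [← Finset.sum_image (f := g) fun _ _ _ _ h => latticePoint_injective h]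
    exact (Finset.sum_subtype _ hmem g).symm
  rw [autocorrelationAt, integral_smul_measure, ENNReal.toReal_inv, Measure.sum_fintype,
    integral_finsetSum_measure fun _ _ => integrable_dirac (by simp), smul_eq_mul]
  congr 1
  simp only [integral_dirac]
  rw [Fintype.sum_prod_type, hsum fun x => ∑ y : (latticePoint '' Z ∩ Metric.ball 0 R : Set _),
    f ((y : EuclideanSpace ℝ (Fin d)) - x)]
  refine Finset.sum_congr rfl fun i _ => ?_
  rw [hsum fun y => f (y - latticePoint i)]
  exact Finset.sum_congr rfl fun j _ => by rw [latticePoint_sub]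

/-- Sorting the pairs of points of a finite set of lattice points by their difference. -/
theorem sum_sum_sub_eq (G K : Finset (Fin d → ℤ)) (φ : (Fin d → ℤ) → ℝ) (hφ : ∀ k, k ∉ K → φ k = 0) :
    ∑ i ∈ G, ∑ j ∈ G, φ (j - i) = ∑ k ∈ K, φ k * (G.filter fun i => i + k ∈ G).card := by
  classical
  have h : ∀ i ∈ G, ∑ j ∈ G, φ (j - i) = ∑ k ∈ K, if i + k ∈ G then φ k else 0 := by
    intro i _
    -- Extending the sum to all of `ℤ^d` allows the substitution `j = i + k`, under which `G` itself
    -- is not invariant.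
    calc ∑ j ∈ G, φ (j - i) = ∑' j, if j ∈ G then φ (j - i) else 0 := by
          rw [tsum_eq_sum (s := G) fun j hj => if_neg hj]
          exact Finset.sum_congr rfl fun j hj => (if_pos hj).symm
      _ = ∑' k, if i + k ∈ G then φ k else 0 := by
          rw [← (Equiv.addLeft i).tsum_eq]
          simp
      _ = _ := tsum_eq_sum fun k hk => by simp [hφ k hk]
  rw [Finset.sum_congr rfl h, Finset.sum_comm]
  refine Finset.sum_congr rfl fun k _ => ?_
  rw [← Finset.sum_filter, Finset.sum_const, nsmul_eq_mul, mul_comm]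

/-- Counting pairs with difference `k`, the second point need not be constrained to lie in the ball. -/
theorem tendsto_card_filter_pair (Z : Set (Fin d → ℤ)) [DecidablePred (· ∈ Z)] (k : Fin d → ℤ) {c : ℝ}
    (hc : Tendsto (fun R => (((latticeBall d R).filter fun i => i ∈ Z ∧ i + k ∈ Z).card : ℝ)
      / ballVolume d R) atTop (𝓝 c)) :
    Tendsto (fun R => ((((latticeBall d R).filter (· ∈ Z)).filter fun i =>
      i + k ∈ (latticeBall d R).filter (· ∈ Z)).card : ℝ) / ballVolume d R) atTop (𝓝 c) := by
  classical
  have hlow := hc.sub (tendsto_card_latticeBall_sub_div d ‖latticePoint k‖)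
  rw [sub_zero] at hlow
  refine tendsto_of_tendsto_of_tendsto_of_le_of_le' hlow hc ?_ ?_
  · filter_upwards [eventually_gt_atTop 0] with R hR
    rw [← sub_div]
    refine div_le_div_of_nonneg_right ?_ (ballVolume_pos hR).le
    have hle : latticeBall d (R - ‖latticePoint k‖) ⊆ latticeBall d R :=
      latticeBall_mono (sub_le_self _ (norm_nonneg _))
    -- If `‖i‖ < R - ‖k‖` then `i + k` is still in the ball, so a discarded pair has `i` in a shell
    -- of width `‖k‖`.
    have hsub : (latticeBall d R).filter (fun i => i ∈ Z ∧ i + k ∈ Z) ⊆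
        (((latticeBall d R).filter (· ∈ Z)).filter fun i =>
          i + k ∈ (latticeBall d R).filter (· ∈ Z)) ∪
        (latticeBall d R \ latticeBall d (R - ‖latticePoint k‖)) := by
      intro i hi
      simp only [Finset.mem_filter, Finset.mem_union, Finset.mem_sdiff, mem_latticeBall] at hi ⊢
      by_cases h : ‖latticePoint i‖ < R - ‖latticePoint k‖
      · refine Or.inl ⟨⟨hi.1, hi.2.1⟩, ?_, hi.2.2⟩
        rw [latticePoint_add]
        linarith [norm_add_le (latticePoint i) (latticePoint k)]
      · exact Or.inr ⟨hi.1, h⟩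
    have h1 := (Finset.card_le_card hsub).trans (Finset.card_union_le _ _)
    have h2 := Finset.card_sdiff_add_card_eq_card hle
    have h1' : (((latticeBall d R).filter fun i => i ∈ Z ∧ i + k ∈ Z).card : ℝ) ≤
      (((latticeBall d R).filter (· ∈ Z)).filter fun i =>
          i + k ∈ (latticeBall d R).filter (· ∈ Z)).card +
        (latticeBall d R \ latticeBall d (R - ‖latticePoint k‖)).card := by exact_mod_cast h1
    have h2' : ((latticeBall d R \ latticeBall d (R - ‖latticePoint k‖)).card : ℝ) +
      (latticeBall d (R - ‖latticePoint k‖)).card = (latticeBall d R).card := by exact_mod_cast h2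
    linarith
  · filter_upwards [eventually_gt_atTop 0] with R hR
    refine div_le_div_of_nonneg_right ?_ (ballVolume_pos hR).le
    refine Nat.cast_le.2 (Finset.card_le_card fun i hi => ?_)
    simp only [Finset.mem_filter] at hi ⊢
    exact ⟨hi.1.1, hi.1.2, hi.2.2⟩

theorem isLocallyFiniteMeasure_sum_smul_dirac (c : (Fin d → ℤ) → ℝ) :
    IsLocallyFiniteMeasure (Measure.sum fun k : Fin d → ℤ =>
      ENNReal.ofReal (c k) • Measure.dirac (latticePoint k)) := by
  refine ⟨fun x => ⟨Metric.ball 0 (‖x‖ + 1), Metric.isOpen_ball.mem_nhds (by simp), ?_⟩⟩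
  rw [Measure.sum_apply _ measurableSet_ball, tsum_eq_sum (s := latticeBall d (‖x‖ + 1))]
  · exact ENNReal.sum_lt_top.2 fun k _ =>
      ENNReal.mul_lt_top ENNReal.ofReal_lt_top (measure_lt_top (Measure.dirac (latticePoint k)) _)
  · intro k hk
    rw [mem_latticeBall, ← mem_ball_zero_iff] at hk
    rw [Measure.smul_apply, Measure.dirac_apply' _ measurableSet_ball, Set.indicator_of_notMem hk,
      smul_zero]

/-- A set of lattice points in which the pairs with difference `k` have density `c k` for every `k`
has the autocorrelation `∑ c k δ_k`. -/
theorem isAutocorrelation_image_latticePoint (Z : Set (Fin d → ℤ)) [DecidablePred (· ∈ Z)]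
    {c : (Fin d → ℤ) → ℝ} (hc0 : ∀ k, 0 ≤ c k)
    (hc : ∀ k, Tendsto (fun R => (((latticeBall d R).filter fun i => i ∈ Z ∧ i + k ∈ Z).card : ℝ)
      / ballVolume d R) atTop (𝓝 (c k))) :
    IsAutocorrelation (latticePoint '' Z) (Measure.sum fun k : Fin d → ℤ =>
      ENNReal.ofReal (c k) • Measure.dirac (latticePoint k)) where
  finite_inter_ball R := by
    classical
    exact (Finset.finite_toSet _).subset fun x hx =>
      (mem_image_latticePoint_inter_ball_iff (Z := Z) x).2 hx
  isLocallyFinite := isLocallyFiniteMeasure_sum_smul_dirac c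
  tendsto f hf hfc := by
    obtain ⟨K, hK⟩ := exists_finset_of_hasCompactSupport hfc
    have := isLocallyFiniteMeasure_sum_smul_dirac c
    have hlim : ∫ x, f x ∂(Measure.sum fun k : Fin d → ℤ =>
        ENNReal.ofReal (c k) • Measure.dirac (latticePoint k)) = ∑ k ∈ K, f (latticePoint k) * c k := by
      rw [integral_sum_measure (hf.integrable_of_hasCompactSupport hfc), tsum_eq_sum (s := K)]
      · refine Finset.sum_congr rfl fun k _ => ?_
        rw [integral_smul_measure, integral_dirac, ENNReal.toReal_ofReal (hc0 k), smul_eq_mul, mul_comm]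
      · intro k hk
        rw [integral_smul_measure, integral_dirac, hK k hk, smul_zero]
    rw [hlim]
    refine (tendsto_finsetSum K fun k _ =>
      (tendsto_card_filter_pair Z k (hc k)).const_mul (f (latticePoint k))).congr fun R => ?_
    rw [integral_autocorrelationAt_image_latticePoint,
      sum_sum_sub_eq _ K (fun k => f (latticePoint k)) hK, Finset.mul_sum]
    exact Finset.sum_congr rfl fun k _ => by ring

theorem correlation_nonneg {Ω : Type*} [MeasurableSpace Ω] (P : Measure Ω)
    {X : (Fin d → ℤ) → Ω → ℝ} (hX : ∀ k ω, X k ω = 0 ∨ X k ω = 1) (k : Fin d → ℤ) :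
    0 ≤ correlation P X k :=
  integral_nonneg fun ω => by rcases hX 0 ω with h | h <;> rcases hX k ω with h' | h' <;> simp [h, h']

theorem correlation_le_one {Ω : Type*} [MeasurableSpace Ω] (P : Measure Ω) [IsProbabilityMeasure P]
    {X : (Fin d → ℤ) → Ω → ℝ} (hX : ∀ k ω, X k ω = 0 ∨ X k ω = 1) (k : Fin d → ℤ) :
    correlation P X k ≤ 1 := by
  have h1 : ∀ᵐ ω ∂P, ‖X 0 ω * X k ω‖ ≤ 1 := .of_forall fun ω => by
    rcases hX 0 ω with h | h <;> rcases hX k ω with h' | h' <;> simp [h, h']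
  refine (le_abs_self _).trans ((norm_integral_le_of_norm_le_const h1).trans ?_)
  simp

/-- Almost surely, the random set of points has the autocorrelation `∑ E[X₀ X_k] δ_k`. -/
theorem ae_isAutocorrelation_pointSet {Ω : Type*} [MeasurableSpace Ω] (P : Measure Ω)
    [IsProbabilityMeasure P] {X : (Fin d → ℤ) → Ω → ℝ} (hm : ∀ k, Measurable (X k))
    (hX : ∀ k ω, X k ω = 0 ∨ X k ω = 1) (hstat : IsStationaryProcess P X)
    (herg : IsErgodicProcess P X) :
    ∀ᵐ ω ∂P, IsAutocorrelation (pointSet X ω) (correlationMeasure P X) := by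
  classical
  have hpath : Measurable (path X) := measurable_pi_lambda _ hm
  have : IsProbabilityMeasure (law P X) := Measure.isProbabilityMeasure_map hpath.aemeasurable
  -- On the paths of `X` this indicator equals `y 0 * y k`, but it is bounded on all real
  -- trajectories, as the ergodic theorem requires.
  set f : (Fin d → ℤ) → ((Fin d → ℤ) → ℝ) → ℝ := fun k =>
    {y : (Fin d → ℤ) → ℝ | y 0 = 1 ∧ y k = 1}.indicator 1 with hf
  have hset : ∀ k : Fin d → ℤ, MeasurableSet {y : (Fin d → ℤ) → ℝ | y 0 = 1 ∧ y k = 1} := fun k =>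
    (measurable_pi_apply 0 (measurableSet_singleton 1)).inter
      (measurable_pi_apply k (measurableSet_singleton 1))
  have hfm : ∀ k, Measurable (f k) := fun k => measurable_one.indicator (hset k)
  have hfb : ∀ k y, |f k y| ≤ 1 := fun k y => by
    by_cases h : y ∈ {y : (Fin d → ℤ) → ℝ | y 0 = 1 ∧ y k = 1}
    · simp only [hf, Set.indicator_of_mem h]; simp
    · simp only [hf, Set.indicator_of_notMem h]; simp
  have hint : ∀ k, ∫ y, f k y ∂(law P X) = correlation P X k := fun k => by
    rw [law, integral_map hpath.aemeasurable (hfm k).aestronglyMeasurable, correlation]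
    refine integral_congr_ae (.of_forall fun ω => ?_)
    rcases hX 0 ω with h | h <;> rcases hX k ω with h' | h' <;>
      simp [hf, path, h, h']
  have hae : ∀ᵐ y ∂(law P X), ∀ k,
      Tendsto (fun R => ballAverage (f k) R y) atTop (𝓝 (correlation P X k)) :=
    ae_all_iff.2 fun k => hint k ▸ ae_tendsto_ballAverage
      (fun j => ⟨measurable_shift j, hstat j⟩) herg (hfm k) (hfb k)
  filter_upwards [ae_of_ae_map hpath.aemeasurable hae] with ω hω
  refine isAutocorrelation_image_latticePoint {k | X k ω = 1} (correlation_nonneg P hX)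
    fun k => (hω k).congr fun R => ?_
  rw [ballAverage, Finset.card_filter, Nat.cast_sum]
  congr 1
  refine Finset.sum_congr rfl fun i _ => ?_
  simp [hf, path, shift, Set.indicator_apply, add_comm]

end Autocorrelation

/-! ### Temperedness and lattice sums of Schwartz functions. -/

section Tempered

variable {d : ℕ}

/-- The weight `(1 + ‖x‖)^(-(d + 1))`, which is integrable over `ℝ^d`. -/
def weight (x : EuclideanSpace ℝ (Fin d)) : ℝ := (1 + ‖x‖) ^ (-((d + 1 : ℕ) : ℝ))

theorem weight_nonneg (x : EuclideanSpace ℝ (Fin d)) : 0 ≤ weight x := by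
  unfold weight; positivity

theorem measurable_weight : Measurable (weight (d := d)) := by
  unfold weight; fun_prop

/-- Peetre's inequality, from `1 + ‖x + y‖ ≤ (1 + ‖y‖) * (1 + ‖x‖)`: a bounded translation changes
the weight by a bounded factor. -/
theorem weight_le_mul_weight_add (x y : EuclideanSpace ℝ (Fin d)) :
    weight x ≤ (1 + ‖y‖) ^ (d + 1) * weight (x + y) := by
  have hx : 0 < 1 + ‖x‖ := by positivity
  have hy : 0 < 1 + ‖y‖ := by positivity
  have hxy : 0 < 1 + ‖x + y‖ := by positivity
  simp only [weight, Real.rpow_neg hx.le, Real.rpow_neg hxy.le, Real.rpow_natCast]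
  rw [← div_eq_mul_inv, le_div_iff₀ (by positivity), inv_mul_le_iff₀ (by positivity), ← mul_pow]
  refine pow_le_pow_left₀ hxy.le ?_ _
  nlinarith [norm_add_le x y, norm_nonneg x, norm_nonneg y]

/-- A uniform bound for the periodization of the weight. -/
def weightBound (d : ℕ) : ℝ≥0∞ :=
  ENNReal.ofReal ((1 + (√d + 1)) ^ (d + 1)) *
    ∫⁻ y : EuclideanSpace ℝ (Fin d), ENNReal.ofReal (weight y)

theorem weightBound_lt_top (d : ℕ) : weightBound d < ∞ :=
  ENNReal.mul_lt_top ENNReal.ofReal_lt_top (finite_integral_one_add_norm (by simp))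

/-- Each term is compared with an integral over its cell. The bound is uniform in `x` because
Lebesgue measure is translation invariant; the uniformity permits integration against any finite
`μ`. -/
theorem tsum_weight_add_latticePoint_le (x : EuclideanSpace ℝ (Fin d)) :
    ∑' k : Fin d → ℤ, ENNReal.ofReal (weight (x + latticePoint k)) ≤ weightBound d := by
  have hm : Measurable fun y : EuclideanSpace ℝ (Fin d) => ENNReal.ofReal (weight (x + y)) :=
    (measurable_weight.comp (measurable_const_add x)).ennreal_ofReal
  calc ∑' k : Fin d → ℤ, ENNReal.ofReal (weight (x + latticePoint k))
      ≤ ∑' k : Fin d → ℤ, ∫⁻ y in cell k,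
          ENNReal.ofReal ((1 + (√d + 1)) ^ (d + 1)) * ENNReal.ofReal (weight (x + y)) := by
        refine ENNReal.tsum_le_tsum fun k => ?_
        calc ENNReal.ofReal (weight (x + latticePoint k))
            = ∫⁻ _y in cell k, ENNReal.ofReal (weight (x + latticePoint k)) := by
              simp [volume_cell]
          _ ≤ _ := by
            refine setLIntegral_mono (hm.const_mul _) fun y hy => ?_
            rw [← ENNReal.ofReal_mul (by positivity)]
            refine ENNReal.ofReal_le_ofReal
              ((weight_le_mul_weight_add (x + latticePoint k) (y - latticePoint k)).trans ?_)
            rw [add_assoc, add_sub_cancel]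
            refine mul_le_mul_of_nonneg_right (pow_le_pow_left₀ (by positivity) ?_ _)
              (weight_nonneg _)
            linarith [norm_sub_latticePoint_lt hy]
    _ = ∫⁻ y, ENNReal.ofReal ((1 + (√d + 1)) ^ (d + 1)) * ENNReal.ofReal (weight (x + y)) := by
        rw [← lintegral_iUnion measurableSet_cell pairwise_disjoint_cell, iUnion_cell,
          Measure.restrict_univ]
    _ = weightBound d := by
        rw [lintegral_const_mul _ hm, weightBound,
          lintegral_add_left_eq_self (fun y => ENNReal.ofReal (weight y)) x]

theorem hasTemperateGrowth_of_lintegral_weight_lt_top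
    {γ : Measure (EuclideanSpace ℝ (Fin d))} (h : ∫⁻ x, ENNReal.ofReal (weight x) ∂γ < ∞) :
    γ.HasTemperateGrowth := by
  refine ⟨⟨d + 1, measurable_weight.aestronglyMeasurable, ?_⟩⟩
  change HasFiniteIntegral weight γ
  rw [hasFiniteIntegral_iff_ofReal (.of_forall weight_nonneg)]
  exact h

theorem hasTemperateGrowth_sum_smul_dirac {c : (Fin d → ℤ) → ℝ} (hc : ∀ k, c k ≤ 1) :
    (Measure.sum fun k : Fin d → ℤ =>
      ENNReal.ofReal (c k) • Measure.dirac (latticePoint k)).HasTemperateGrowth := by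
  refine hasTemperateGrowth_of_lintegral_weight_lt_top ?_
  rw [lintegral_sum_measure]
  refine lt_of_le_of_lt (ENNReal.tsum_le_tsum fun k => ?_)
    ((tsum_weight_add_latticePoint_le 0).trans_lt (weightBound_lt_top d))
  rw [lintegral_smul_measure, lintegral_dirac, zero_add, smul_eq_mul]
  exact mul_le_of_le_one_left' (ENNReal.ofReal_le_one.2 (hc k))

theorem lintegral_periodization {μ : Measure (EuclideanSpace ℝ (Fin d))}
    {f : EuclideanSpace ℝ (Fin d) → ℝ≥0∞} (hf : Measurable f) :
    ∫⁻ x, f x ∂(periodization μ) = ∫⁻ x, ∑' k, f (x + latticePoint k) ∂μ := by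
  rw [periodization, lintegral_sum_measure, lintegral_tsum (f := fun k x => f (x + latticePoint k))
    fun k => (hf.comp (measurable_add_const (latticePoint k))).aemeasurable]
  exact tsum_congr fun k => lintegral_map hf (measurable_add_const _)

theorem hasTemperateGrowth_periodization (μ : Measure (EuclideanSpace ℝ (Fin d)))
    [IsFiniteMeasure μ] : (periodization μ).HasTemperateGrowth := by
  refine hasTemperateGrowth_of_lintegral_weight_lt_top ?_
  rw [lintegral_periodization measurable_weight.ennreal_ofReal]
  refine (lintegral_mono fun x => tsum_weight_add_latticePoint_le x).trans_lt ?_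
  rw [lintegral_const]
  exact ENNReal.mul_lt_top (weightBound_lt_top d) (measure_lt_top _ _)

theorem exists_norm_le_mul_weight (φ : 𝓢(EuclideanSpace ℝ (Fin d), ℂ)) :
    ∃ C : ℝ, 0 ≤ C ∧ ∀ x, ‖φ x‖ ≤ C * weight x := by
  refine ⟨2 ^ (d + 1) * ((Finset.Iic (d + 1, 0)).sup fun m => SchwartzMap.seminorm ℝ m.1 m.2) φ,
    mul_nonneg (by positivity) (apply_nonneg _ _), fun x => ?_⟩
  have h := SchwartzMap.one_add_le_sup_seminorm_apply (𝕜 := ℝ) (m := (d + 1, 0)) le_rfl le_rfl φ x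
  rw [norm_iteratedFDeriv_zero] at h
  rw [weight, Real.rpow_neg (by positivity), Real.rpow_natCast, ← div_eq_mul_inv,
    le_div_iff₀ (by positivity), mul_comm]
  exact h

theorem exists_tsum_enorm_le (φ : 𝓢(EuclideanSpace ℝ (Fin d), ℂ)) :
    ∃ B : ℝ≥0∞, B < ∞ ∧ ∀ x, ∑' k : Fin d → ℤ, ‖φ (x + latticePoint k)‖ₑ ≤ B := by
  obtain ⟨C, hC, h⟩ := exists_norm_le_mul_weight φ
  refine ⟨ENNReal.ofReal C * weightBound d,
    ENNReal.mul_lt_top ENNReal.ofReal_lt_top (weightBound_lt_top d), fun x => ?_⟩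
  refine le_trans (ENNReal.tsum_le_tsum fun k => ?_)
    ((ENNReal.tsum_mul_left.trans_le (mul_le_mul_right (tsum_weight_add_latticePoint_le x) _)))
  rw [← ENNReal.ofReal_mul hC, ← ofReal_norm]
  exact ENNReal.ofReal_le_ofReal (h _)

theorem summable_weight_latticePoint (d : ℕ) :
    Summable fun k : Fin d → ℤ => weight (latticePoint k) := by
  have h := ((tsum_weight_add_latticePoint_le (0 : EuclideanSpace ℝ (Fin d))).trans_lt
    (weightBound_lt_top d)).ne
  refine (ENNReal.summable_toReal h).congr fun k => ?_
  rw [zero_add, ENNReal.toReal_ofReal (weight_nonneg _)]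

theorem summable_apply_latticePoint (φ : 𝓢(EuclideanSpace ℝ (Fin d), ℂ)) :
    Summable fun k : Fin d → ℤ => φ (latticePoint k) := by
  obtain ⟨C, -, h⟩ := exists_norm_le_mul_weight φ
  exact .of_norm_bounded ((summable_weight_latticePoint d).mul_left C) fun k => h _

theorem continuous_tsum_add_latticePoint (φ : 𝓢(EuclideanSpace ℝ (Fin d), ℂ)) :
    Continuous fun x => ∑' k : Fin d → ℤ, φ (x + latticePoint k) := by
  obtain ⟨C, hC, h⟩ := exists_norm_le_mul_weight φ
  refine continuous_iff_continuousAt.2 fun x => ?_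
  have hcont : ContinuousOn (fun x => ∑' k : Fin d → ℤ, φ (x + latticePoint k))
      (Metric.ball 0 (‖x‖ + 1)) := by
    refine continuousOn_tsum (u := fun k => C * ((1 + (‖x‖ + 1)) ^ (d + 1) * weight (latticePoint k)))
      (fun k => ?_) (((summable_weight_latticePoint d).mul_left _).mul_left _) fun k y hy => ?_
    · exact (φ.continuous.comp (continuous_add_const _)).continuousOn
    · rw [mem_ball_zero_iff] at hy
      refine (h _).trans (mul_le_mul_of_nonneg_left ?_ hC)
      -- Translating back by `-y` dominates the terms by a summable sequence independent of `y` in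
      -- the ball, as the M-test needs.
      have := weight_le_mul_weight_add (y + latticePoint k) (-y)
      rw [show y + latticePoint k + -y = latticePoint k by abel, norm_neg] at this
      refine this.trans (mul_le_mul_of_nonneg_right (pow_le_pow_left₀ (by positivity) ?_ _)
        (weight_nonneg _))
      linarith
  exact hcont.continuousAt (Metric.isOpen_ball.mem_nhds (by simp))

end Tempered

/-! ### Poisson summation through Fourier series on the torus. -/

section Poisson

variable {d : ℕ}

/-- An integral over `ℝ^d` is the integral of the periodization over the unit cube. -/
theorem integral_eq_setIntegral_tsum {ψ : EuclideanSpace ℝ (Fin d) → ℂ} (hψ : Integrable ψ) :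
    ∫ x, ψ x = ∫ x in cell 0, ∑' k : Fin d → ℤ, ψ (x + latticePoint k) := by
  have hpre : ∀ k : Fin d → ℤ, (fun x => x + latticePoint k) ⁻¹' cell k = cell 0 := fun k =>
    Set.ext fun x => add_mem_cell_iff
  have hmp : ∀ k : Fin d → ℤ, MeasurePreserving (fun x => x + latticePoint k)
    (volume.restrict (cell 0)) (volume.restrict (cell k)) := fun k => by
    have := (measurePreserving_add_right volume (latticePoint k)).restrict_preimage
      (measurableSet_cell k)
    rwa [hpre] at this
  rw [integral_tsum]
  · rw [← setIntegral_univ, ← iUnion_cell,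
      integral_iUnion measurableSet_cell pairwise_disjoint_cell hψ.integrableOn]
    exact tsum_congr fun k => ((hmp k).integral_comp (measurableEmbedding_addRight _) ψ).symm
  · exact fun k => (hψ.aestronglyMeasurable.restrict).comp_measurePreserving (hmp k)
  · have : ∀ k : Fin d → ℤ, ∫⁻ x in cell 0, ‖ψ (x + latticePoint k)‖ₑ = ∫⁻ x in cell k, ‖ψ x‖ₑ :=
      fun k => (hmp k).lintegral_comp_emb (measurableEmbedding_addRight _) fun x => ‖ψ x‖ₑ
    rw [tsum_congr this, ← lintegral_iUnion measurableSet_cell pairwise_disjoint_cell, iUnion_cell,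
      Measure.restrict_univ]
    exact hψ.hasFiniteIntegral.ne

/-- The character `x ↦ exp (2π i ⟨k, x⟩)`. -/
def character (k : Fin d → ℤ) (x : EuclideanSpace ℝ (Fin d)) : ℂ :=
  Complex.exp (2 * Real.pi * Complex.I * ((inner ℝ (latticePoint k) x : ℝ) : ℂ))

theorem mFourier_coe (k : Fin d → ℤ) (x : EuclideanSpace ℝ (Fin d)) :
    UnitAddTorus.mFourier k (fun i => (x i : UnitAddCircle)) = character k x := by
  simp only [UnitAddTorus.mFourier, ContinuousMap.coe_mk, fourier_coe_apply]
  rw [← Complex.exp_sum, character, PiLp.inner_apply]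
  congr 1
  push_cast
  rw [Finset.mul_sum]
  refine Finset.sum_congr rfl fun i _ => ?_
  simp
  ring

theorem norm_character (k : Fin d → ℤ) (x : EuclideanSpace ℝ (Fin d)) : ‖character k x‖ = 1 := by
  rw [character, show (2 * Real.pi * Complex.I * ((inner ℝ (latticePoint k) x : ℝ) : ℂ)) =
    ((2 * Real.pi * inner ℝ (latticePoint k) x : ℝ) : ℂ) * Complex.I by push_cast; ring]
  exact Complex.norm_exp_ofReal_mul_I _

theorem continuous_character (k : Fin d → ℤ) : Continuous (character k) := by
  unfold character; fun_prop

theorem character_add_latticePoint (k j : Fin d → ℤ) (x : EuclideanSpace ℝ (Fin d)) :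
    character k (x + latticePoint j) = character k x := by
  rw [← mFourier_coe, ← mFourier_coe]
  congr 1
  ext i
  simp

theorem fourier_latticePoint (φ : 𝓢(EuclideanSpace ℝ (Fin d), ℂ)) (k : Fin d → ℤ) :
    𝓕 φ (latticePoint k) = ∫ x, character (-k) x * φ x := by
  rw [SchwartzMap.fourier_coe, Real.fourier_eq']
  refine integral_congr_ae (.of_forall fun x => ?_)
  have : (latticePoint (-k) : EuclideanSpace ℝ (Fin d)) = -latticePoint k := by
    rw [← zero_sub, latticePoint_sub, latticePoint_zero, zero_sub]
  have hin : inner ℝ x (latticePoint k) = inner ℝ (latticePoint k) x := real_inner_comm _ _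
  simp only [character, this, inner_neg_left, smul_eq_mul, hin]
  congr 2
  push_cast
  ring

/-- The **Poisson summation formula** in `ℝ^d`. -/
theorem hasSum_fourier_mul_character (φ : 𝓢(EuclideanSpace ℝ (Fin d), ℂ))
    (x : EuclideanSpace ℝ (Fin d)) :
    HasSum (fun k : Fin d → ℤ => 𝓕 φ (latticePoint k) * character k x)
      (∑' k : Fin d → ℤ, φ (x + latticePoint k)) := by
  set Φ : EuclideanSpace ℝ (Fin d) → ℂ := fun x => ∑' k : Fin d → ℤ, φ (x + latticePoint k) with hΦ
  set q : (Fin d → ℝ) → UnitAddTorus (Fin d) := Pi.map fun _ => ((↑) : ℝ → UnitAddCircle) with hq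
  have hquot : IsOpenQuotientMap q :=
    IsOpenQuotientMap.piMap fun _ => QuotientAddGroup.isOpenQuotientMap_mk
  set Φ' : C(Fin d → ℝ, ℂ) := ⟨fun y => Φ (WithLp.toLp 2 y),
    (continuous_tsum_add_latticePoint φ).comp (PiLp.continuous_toLp 2 _)⟩ with hΦ'
  have hlift : Function.FactorsThrough Φ' q := by
    intro y z hyz
    have hk : ∀ i, ∃ n : ℤ, y i = z i + n := fun i => by
      have h := congrFun hyz i
      simp only [hq, Pi.map_apply] at h
      rw [← sub_eq_zero, ← AddCircle.coe_sub, AddCircle.coe_eq_zero_iff] at h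
      obtain ⟨n, hn⟩ := h
      exact ⟨n, by rw [zsmul_one] at hn; linarith⟩
    choose k hk using hk
    have : (WithLp.toLp 2 y : EuclideanSpace ℝ (Fin d)) = WithLp.toLp 2 z + latticePoint k := by
      ext i; simp [hk]
    simp only [hΦ', hΦ, ContinuousMap.coe_mk, this]
    rw [← (Equiv.addLeft k).tsum_eq fun j => φ (WithLp.toLp 2 z + latticePoint j)]
    simp [latticePoint_add, add_assoc]
  set qc : C(Fin d → ℝ, UnitAddTorus (Fin d)) := ⟨q, hquot.continuous⟩ with hqc
  have hqcq : IsQuotientMap qc := hquot.isQuotientMap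
  -- The periodization of `φ` is continuous and constant on the fibres of a quotient map, so it
  -- descends to a continuous function on the torus, whose Fourier series is then evaluated.
  set G : C(UnitAddTorus (Fin d), ℂ) := hqcq.lift Φ' hlift with hG
  have hGq : ∀ y : EuclideanSpace ℝ (Fin d), G (fun i => (y i : UnitAddCircle)) = Φ y := fun y =>
    congrArg (fun g : C(Fin d → ℝ, ℂ) => g y.ofLp) (hqcq.lift_comp Φ' hlift)
  have hcoeff : ∀ k, UnitAddTorus.mFourierCoeff G k = 𝓕 φ (latticePoint k) := by
    intro k
    have hint : Integrable fun x => character (-k) x * φ x :=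
      φ.integrable.bdd_mul (continuous_character _).aestronglyMeasurable
        (.of_forall fun x => (norm_character (-k) x).le)
    -- Unfolding: the integral over `ℝ^d` becomes one over the unit cube, where the periodic
    -- character factors out of the sum.
    rw [fourier_latticePoint, integral_eq_setIntegral_tsum hint,
      UnitAddTorus.mFourierCoeff_eq_integral G k 0]
    have hpre : {x : Fin d → ℝ | ∀ i, x i ∈ Set.Ioc ((0 : Fin d → ℝ) i) ((0 : Fin d → ℝ) i + 1)} =
        WithLp.toLp 2 ⁻¹' cell 0 := by
      ext x; simp [cell]
    rw [hpre, ← (PiLp.volume_preserving_toLp (Fin d)).setIntegral_preimage_emb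
      (MeasurableEquiv.toLp 2 (Fin d → ℝ)).measurableEmbedding]
    refine setIntegral_congr_fun ?_ fun y _ => ?_
    · exact (PiLp.volume_preserving_toLp (Fin d)).measurable (measurableSet_cell 0)
    · simp only [character_add_latticePoint, tsum_mul_left]
      rw [← mFourier_coe, smul_eq_mul]
      congr 1
      exact hGq (WithLp.toLp 2 y)
  -- The coefficients are values of the Schwartz function `𝓕 φ` at lattice points; their summability
  -- makes the series converge at every point.
  have hsum : Summable (UnitAddTorus.mFourierCoeff G) := by
    rw [funext hcoeff]
    exact summable_apply_latticePoint (𝓕 φ)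
  have := UnitAddTorus.hasSum_mFourier_series_apply_of_summable hsum fun i => (x i : UnitAddCircle)
  rw [hGq] at this
  simpa only [hcoeff, mFourier_coe, smul_eq_mul] using this

end Poisson

/-! ### The Fourier transform of the autocorrelation. -/

section Fourier

variable {d : ℕ}

theorem hasFourierMeasure_sum_smul_dirac_periodization {c : (Fin d → ℤ) → ℝ} (hc0 : ∀ k, 0 ≤ c k)
    (hc1 : ∀ k, c k ≤ 1) (μ : Measure (EuclideanSpace ℝ (Fin d))) [IsFiniteMeasure μ]
    (hμ : ∀ k, ∫ x, character k x ∂μ = c k) :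
    HasFourierMeasure (Measure.sum fun k : Fin d → ℤ =>
      ENNReal.ofReal (c k) • Measure.dirac (latticePoint k)) (periodization μ) := by
  have hγ := hasTemperateGrowth_sum_smul_dirac hc1
  have hν := hasTemperateGrowth_periodization μ
  refine ⟨hγ, hν, ?_⟩
  ext φ
  rw [TemperedDistribution.fourier_apply]
  change ∫ x, 𝓕 φ x ∂_ = ∫ x, φ x ∂_
  rw [integral_sum_measure (𝓕 φ).integrable]
  have hR : ∫ x, φ x ∂(periodization μ) = ∫ x, ∑' k, φ (x + latticePoint k) ∂μ := by
    rw [integral_tsum]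
    · have : Integrable φ (periodization μ) := φ.integrable
      rw [periodization] at this ⊢
      rw [integral_sum_measure this]
      exact tsum_congr fun k => integral_map (measurable_add_const _).aemeasurable
        φ.continuous.aestronglyMeasurable
    · exact fun k => (φ.continuous.comp (continuous_add_const _)).aestronglyMeasurable
    · obtain ⟨B, hB, h⟩ := exists_tsum_enorm_le φ
      rw [← lintegral_tsum (f := fun k x => ‖φ (x + latticePoint k)‖ₑ) fun k =>
        (φ.continuous.comp (continuous_add_const (latticePoint k))).enorm.measurable.aemeasurable]
      refine ((lintegral_mono h).trans_lt ?_).ne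
      rw [lintegral_const]
      exact ENNReal.mul_lt_top hB (measure_lt_top _ _)
  rw [hR]
  -- Poisson summation is used pointwise under the integral; exchanging sum and integral then turns
  -- each character into its coefficient `c k`.
  simp_rw [← fun x => (hasSum_fourier_mul_character φ x).tsum_eq]
  rw [integral_tsum]
  · refine tsum_congr fun k => ?_
    rw [integral_smul_measure, integral_dirac, ENNReal.toReal_ofReal (hc0 k), integral_const_mul,
      hμ, mul_comm]
    simp
  · exact fun k => ((continuous_character k).const_mul _).aestronglyMeasurable
  · obtain ⟨B, hB, h⟩ := exists_tsum_enorm_le (𝓕 φ)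
    -- Characters have modulus one, so the exchange needs only the summability of `𝓕 φ` over the
    -- lattice and the finiteness of `μ`.
    have h0 : ∀ k, ∫⁻ x, ‖𝓕 φ (latticePoint k) * character k x‖ₑ ∂μ =
        ‖𝓕 φ (latticePoint k)‖ₑ * μ Set.univ := fun k => by
      rw [← lintegral_const]
      refine lintegral_congr fun x => ?_
      rw [enorm_mul, ← ofReal_norm (character k x), norm_character, ENNReal.ofReal_one,
        mul_one]
    rw [tsum_congr h0, ENNReal.tsum_mul_right]
    have := h 0
    simp only [zero_add] at this
    exact ENNReal.mul_ne_top (this.trans_lt hB).ne (measure_ne_top _ _)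

end Fourier

end

end LatticeDiffraction

theorem theorem2 {d : ℕ} {Ω : Type*} [MeasurableSpace Ω] (P : Measure Ω) [IsProbabilityMeasure P]
    (X : (Fin d → ℤ) → Ω → ℝ)
    (hX_meas : ∀ k, Measurable (X k))
    (hX_values : ∀ k ω, X k ω = 0 ∨ X k ω = 1)
    (hX_stationary : IsStationaryProcess P X)
    (hX_ergodic : IsErgodicProcess P X)
    (μ : Measure (EuclideanSpace ℝ (Fin d)))
    (hμ : IsSpectralMeasure P X μ) :
    (∀ᵐ ω ∂P, IsAutocorrelation (pointSet X ω) (correlationMeasure P X)) ∧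
      HasFourierMeasure (correlationMeasure P X) (periodization μ) ∧
      (∀ᵐ ω ∂P, IsDiffractionMeasure (pointSet X ω) (periodization μ)) := by
  have := hμ.isFinite
  have hauto := ae_isAutocorrelation_pointSet P hX_meas hX_values hX_stationary hX_ergodic
  have hfourier : HasFourierMeasure (correlationMeasure P X) (periodization μ) :=
    hasFourierMeasure_sum_smul_dirac_periodization (correlation_nonneg P hX_values)
      (correlation_le_one P hX_values) μ hμ.fourierCoeff_eq
  exact ⟨hauto, hfourier, hauto.mono fun ω hω => ⟨_, hω, hfourier⟩⟩
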